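/- Let $S$ be a finite set of points in the Euclidean plane, not all on one line. A Delaunay triangulation of $S$ is a triangulation of the convex hull of $S$ (a geometric simplicial complex whose underlying space is the convex hull) whose vertex set is exactly $S$ and such that the circumcircle of each of its triangles has no point of $S$ in its interior. Let $\mathrm{DT}$ be any Delaunay triangulation of $S$, and let $\mathrm{MST}$ be any Euclidean minimum spanning tree of $S$, that is, a tree with vertex set $S$ whose weight is least among all such trees. Here the weight $w$ of a graph on $S$ (for $\mathrm{DT}$, the graph formed by its edges, each counted once) is the sum of the Euclidean lengths of its edges. Let $\alpha>0$ be such that every angle of every triangle of $\mathrm{DT}$ is at least $\alpha$. Then \[ w(\mathrm{DT}) \le \frac{1+\cos\alpha}{1-\cos\alpha}\, w(\mathrm{MST}). \] -/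

import Mathlib

noncomputable section

/-- The Euclidean plane. -/
abbrev Plane : Type := EuclideanSpace ℝ (Fin 2)

/-- `K` is a triangulation of the finite set `S` of sites: a geometric simplicial complex whose
vertices are exactly the sites and whose cells cover exactly the convex hull of the sites. -/
structure IsTriangulation (S : Finset Plane) (K : Geometry.SimplicialComplex ℝ Plane) : Prop where
  vertices_eq : K.vertices = (S : Set Plane)
  space_eq : K.space = convexHull ℝ (S : Set Plane)

/-- `K` is a Delaunay triangulation of `S`: a triangulation of `S` such that the circle through the
three vertices of any triangle of `K` has no site in its interior. -/
structure IsDelaunayTriangulation (S : Finset Plane) (K : Geometry.SimplicialComplex ℝ Plane) :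
    Prop extends IsTriangulation S K where
  empty_circumcircle : ∀ t ∈ K.faces, t.card = 3 →
    ∀ C : EuclideanGeometry.Sphere Plane, (∀ v ∈ t, v ∈ C) →
      ∀ s ∈ S, C.radius ≤ dist s C.center

/-- Every (interior) angle of every triangle of `K` is at least `α`. -/
def AnglesAtLeast (K : Geometry.SimplicialComplex ℝ Plane) (α : ℝ) : Prop :=
  ∀ t ∈ K.faces, t.card = 3 →
    ∀ a ∈ t, ∀ b ∈ t, ∀ c ∈ t, a ≠ b → b ≠ c → a ≠ c → α ≤ EuclideanGeometry.angle a b c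

open Classical in
/-- The graph on the sites `S` formed by the edges (the one-dimensional faces) of `K`. -/
def edgeGraph (S : Finset Plane) (K : Geometry.SimplicialComplex ℝ Plane) : SimpleGraph S where
  Adj p q := p ≠ q ∧ ({(p : Plane), (q : Plane)} : Finset Plane) ∈ K.faces
  symm := ⟨fun p q h => ⟨h.1.symm, by rw [Finset.pair_comm]; exact h.2⟩⟩
  loopless := ⟨fun _ h => h.1 rfl⟩

/-- The Euclidean length of the segment between two sites. -/
def edgeLength {S : Finset Plane} : Sym2 S → ℝ :=
  Sym2.lift ⟨fun p q => dist (p : Plane) (q : Plane), fun p q => dist_comm (p : Plane) (q : Plane)⟩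

open Classical in
/-- The weight of a geometric graph on `S`: the sum of the Euclidean lengths of its edges. -/
def weight {S : Finset Plane} (G : SimpleGraph S) : ℝ :=
  ∑ e ∈ G.edgeFinset, edgeLength e

/-- `T` is a Euclidean minimum spanning tree of `S`: a tree with vertex set `S` whose weight is
least among all trees with vertex set `S`. -/
structure IsEuclideanMST (S : Finset Plane) (T : SimpleGraph S) : Prop where
  isTree : T.IsTree
  weight_le : ∀ T' : SimpleGraph S, T'.IsTree → weight T ≤ weight T'

end

open Filter Topology

/-! The tree lies in the triangulation (`IsEuclideanMST.le_edgeGraph`): an exchange argument shows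
that the closed disk with a tree edge as diameter contains no third site, and such an edge belongs
to every Delaunay triangulation.

The edges outside the tree can be assigned to distinct triangles containing them
(`IsTriangulation.exists_injective`). To see this, let `M` be the incidence matrix of non-tree edges
and triangles over `ZMod 2`, and let `N` record which triangles the fundamental cycle of each
non-tree edge encloses, by ray-crossing parity. Crossing an edge changes this parity by the
multiplicity of the edge in the cycle, and a fundamental cycle uses just one non-tree edge, so `M *
N = 1`. Expanding the determinant yields an injective choice of nonzero entries of `M`.

In a triangle with angles at least `α`, each side is at most `cos α` times the sum of the other two
(`dist_le_cos_mul`). Apply this to every non-tree edge in its assigned triangle and add up. A tree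
edge appears on the right at most twice, since it lies in at most two triangles; a non-tree edge
appears at most once, since in its own triangle it is on the left. Hence `w(DT) - w(T) ≤ cos α *
(w(DT) + w(T))`, which rearranges to the claim. -/

theorem edgeLength_nonneg {S : Finset Plane} (e : Sym2 S) : 0 ≤ edgeLength e := by
  induction e with
  | _ p q => exact dist_nonneg (x := (p : Plane)) (y := q)

theorem weight_eq_sum {S : Finset Plane} (G : SimpleGraph S) [Fintype G.edgeSet] :
    weight G = ∑ e ∈ G.edgeFinset, edgeLength e := by
  unfold weight
  congr!

theorem weight_mono {S : Finset Plane} {G H : SimpleGraph S} (h : G ≤ H) :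
    weight G ≤ weight H := by
  classical
  unfold weight
  refine Finset.sum_le_sum_of_subset_of_nonneg ?_ fun e _ _ => edgeLength_nonneg e
  intro e
  simp only [SimpleGraph.mem_edgeFinset]
  exact fun he => SimpleGraph.edgeSet_mono h he

/-! ### Edge exchange in minimum spanning trees -/

theorem SimpleGraph.Walk.reachable_deleteEdges_or {V : Type*} {T : SimpleGraph V} {a b : V}
    {c d : V} (w : T.Walk c d) :
    d = a → (T.deleteEdges {s(a, b)}).Reachable c a ∨
      (T.deleteEdges {s(a, b)}).Reachable c b := by
  induction w with
  | nil => rintro rfl; exact Or.inl (SimpleGraph.Reachable.refl _)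
  | @cons u v w h p ih =>
    intro hd
    by_cases he : s(u, v) = s(a, b)
    · rcases Sym2.eq_iff.1 he with ⟨rfl, rfl⟩ | ⟨rfl, rfl⟩
      · exact Or.inl (SimpleGraph.Reachable.refl _)
      · exact Or.inr (SimpleGraph.Reachable.refl _)
    · have hadj : (T.deleteEdges {s(a, b)}).Adj u v := by
        rw [SimpleGraph.deleteEdges_adj]; exact ⟨h, he⟩
      exact (ih hd).imp hadj.reachable.trans hadj.reachable.trans

/-- Replacing `ab` by `bc` keeps the graph connected because `c` is on the side of `a`. A spanning
tree of the new graph weighs no less than `T`, so it need not be shown that the new graph is itself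
a tree. -/
theorem IsEuclideanMST.dist_le_of_reachable {S : Finset Plane} {T : SimpleGraph S}
    (hT : IsEuclideanMST S T) {a b c : S} (hab : T.Adj a b) (hcb : c ≠ b)
    (hca : (T.deleteEdges {s(a, b)}).Reachable c a) :
    dist (a : Plane) b ≤ dist (b : Plane) c := by
  classical
  set G := T.deleteEdges {s(a, b)} ⊔ SimpleGraph.edge b c with hG
  have hbc : G.Adj b c := by
    rw [hG, SimpleGraph.sup_adj, SimpleGraph.edge_adj]
    exact Or.inr ⟨Or.inl ⟨rfl, rfl⟩, hcb.symm⟩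
  have hba : G.Reachable b a := hbc.reachable.trans (hca.mono le_sup_left)
  have hstep : ∀ u v, T.Adj u v → G.Reachable u v := by
    intro u v huv
    by_cases he : s(u, v) = s(a, b)
    · rcases Sym2.eq_iff.1 he with ⟨rfl, rfl⟩ | ⟨rfl, rfl⟩
      exacts [hba.symm, hba]
    · have : (T.deleteEdges {s(a, b)}).Adj u v := by
        rw [SimpleGraph.deleteEdges_adj]; exact ⟨huv, he⟩
      exact (this.reachable).mono le_sup_left
  have hreach : ∀ u v, G.Reachable u v := by
    intro u v
    obtain ⟨w⟩ := hT.isTree.connected.preconnected u v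
    induction w with
    | nil => exact SimpleGraph.Reachable.refl _
    | cons h _ ih => exact (hstep _ _ h).trans ih
  have : Nonempty S := ⟨a⟩
  have hconn : G.Connected := ⟨hreach⟩
  obtain ⟨T', hT'G, hT'⟩ := hconn.exists_isTree_le
  have h1 := hT.weight_le T' hT'
  have h2 : weight T' ≤ weight G := weight_mono hT'G
  have h3 : weight G ≤ weight T - dist (a : Plane) b + dist (b : Plane) c := by
    rw [weight_eq_sum G, weight_eq_sum T]
    have hsub : G.edgeFinset ⊆ insert s(b, c) (T.edgeFinset.erase s(a, b)) := by
      intro e he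
      rw [SimpleGraph.mem_edgeFinset] at he
      rw [Finset.mem_insert, Finset.mem_erase, SimpleGraph.mem_edgeFinset]
      induction e with
      | _ u v =>
        rw [SimpleGraph.mem_edgeSet, hG, SimpleGraph.sup_adj, SimpleGraph.deleteEdges_adj,
          SimpleGraph.edge_adj] at he
        rcases he with he | he
        · exact Or.inr ⟨he.2, he.1⟩
        · exact Or.inl (Sym2.eq_iff.2 he.1)
    have hmem : s(a, b) ∈ T.edgeFinset := by simpa using hab
    have h4 := Finset.sum_le_sum_of_subset_of_nonneg (f := edgeLength) hsub
      fun e _ _ => edgeLength_nonneg e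
    have h5 : ∑ e ∈ insert s(b, c) (T.edgeFinset.erase s(a, b)), edgeLength e ≤
        edgeLength s(b, c) + ∑ e ∈ T.edgeFinset.erase s(a, b), edgeLength e := by
      by_cases hmem : s(b, c) ∈ T.edgeFinset.erase s(a, b)
      · rw [Finset.insert_eq_of_mem hmem]
        linarith [edgeLength_nonneg s(b, c)]
      · rw [Finset.sum_insert hmem]
    have h6 := Finset.add_sum_erase T.edgeFinset edgeLength hmem
    have h7 : edgeLength s(a, b) = dist (a : Plane) b := rfl
    have h8 : edgeLength s(b, c) = dist (b : Plane) c := rfl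
    linarith
  linarith

/-- A site other than the end points of an edge `ab` of a minimum spanning tree is not closer to
both `a` and `b` than they are to each other. -/
theorem IsEuclideanMST.dist_le_max {S : Finset Plane} {T : SimpleGraph S}
    (hT : IsEuclideanMST S T) {a b c : S} (hab : T.Adj a b) (hca : c ≠ a) (hcb : c ≠ b) :
    dist (a : Plane) b ≤ dist (a : Plane) c ∨ dist (a : Plane) b ≤ dist (b : Plane) c := by
  obtain ⟨w⟩ := hT.isTree.connected.preconnected c a
  rcases w.reachable_deleteEdges_or (b := b) rfl with h | h
  · exact Or.inr (hT.dist_le_of_reachable hab hcb h)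
  · rw [Sym2.eq_swap] at h
    rw [dist_comm (a : Plane) b]
    exact Or.inl (hT.dist_le_of_reachable hab.symm hca h)

/-- The closed disk with an edge of a minimum spanning tree as diameter contains no further
site. -/
theorem IsEuclideanMST.dist_midpoint_lt {S : Finset Plane} {T : SimpleGraph S}
    (hT : IsEuclideanMST S T) {a b c : S} (hab : T.Adj a b) (hca : c ≠ a) (hcb : c ≠ b) :
    (dist (a : Plane) b / 2) ^ 2 < dist (c : Plane) (midpoint ℝ (a : Plane) b) ^ 2 := by
  by_contra! hlt
  -- By Apollonius, a site `c` in the disk has `|ca|² + |cb|² ≤ |ab|²`. Both terms are positive, so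
  -- both distances are less than `|ab|`.
  have h1 := EuclideanGeometry.dist_sq_add_dist_sq_eq_two_mul_dist_midpoint_sq_add_half_dist_sq
    (c : Plane) a b
  have ha : 0 < dist (a : Plane) c := dist_pos.2 fun h => hca (Subtype.ext h.symm)
  have hb : 0 < dist (b : Plane) c := dist_pos.2 fun h => hcb (Subtype.ext h.symm)
  rw [dist_comm (c : Plane) a, dist_comm (c : Plane) b] at h1
  have := dist_nonneg (x := (a : Plane)) (y := b)
  rcases hT.dist_le_max hab hca hcb with h | h <;> nlinarith

theorem affineSpan_eq_top_of_not_collinear {s : Set Plane} (hs : ¬ Collinear ℝ s) :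
    affineSpan ℝ s = ⊤ := by
  have hne : s.Nonempty := by
    by_contra h
    rw [Set.not_nonempty_iff_eq_empty] at h
    exact hs (h ▸ collinear_empty ℝ Plane)
  rw [AffineSubspace.affineSpan_eq_top_iff_vectorSpan_eq_top_of_nonempty ℝ Plane Plane hne]
  rw [collinear_iff_finrank_le_one] at hs
  apply Submodule.eq_top_of_finrank_eq
  have h1 := Submodule.finrank_le (vectorSpan ℝ s)
  rw [finrank_euclideanSpace_fin] at h1 ⊢
  omega

/-! ### Triangles cover the hull; the spanning tree is Delaunay -/

namespace IsTriangulation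

variable {S : Finset Plane} {K : Geometry.SimplicialComplex ℝ Plane}

theorem subset_sites (hK : IsTriangulation S K) {t : Finset Plane} (ht : t ∈ K.faces) :
    t ⊆ S := by
  intro x hx
  have : x ∈ K.vertices := by
    rw [Geometry.SimplicialComplex.vertices_eq]
    exact Set.mem_biUnion ht hx
  rw [hK.vertices_eq] at this
  exact this

theorem finite_faces (hK : IsTriangulation S K) : K.faces.Finite :=
  (S.powerset.finite_toSet).subset fun _ ht => by
    simpa using hK.subset_sites ht

/-- Every point of the convex hull of the sites lies in a triangle. -/
theorem exists_triangle (hK : IsTriangulation S K) (hS : ¬ Collinear ℝ (S : Set Plane))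
    {x : Plane} (hx : x ∈ convexHull ℝ (S : Set Plane)) :
    ∃ t ∈ K.faces, t.card = 3 ∧ x ∈ convexHull ℝ (t : Set Plane) := by
  set U : Set Plane := ⋃ t ∈ {t ∈ K.faces | t.card = 3}, convexHull ℝ (t : Set Plane) with hU
  have hUclosed : IsClosed U :=
    (hK.finite_faces.subset fun t ht => ht.1).isClosed_biUnion fun t _ =>
      (t.finite_toSet.isCompact_convexHull (𝕜 := ℝ)).isClosed
  -- Faces other than triangles span proper affine subspaces, so the points off these subspaces are
  -- dense. Those in the interior of the hull lie in the closed set `U`, and the closure of the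
  -- interior contains the whole hull.
  set N : Set Plane := ⋃ t ∈ {t ∈ K.faces | t.card ≠ 3}, (affineSpan ℝ (t : Set Plane) : Set Plane)
    with hN
  have hNnull : MeasureTheory.volume N = 0 := by
    rw [hN, MeasureTheory.measure_biUnion_null_iff
      (hK.finite_faces.subset fun t ht => ht.1).countable]
    rintro t ⟨ht, hcard⟩
    apply MeasureTheory.Measure.addHaar_affineSubspace
    intro htop
    apply hcard
    have hind := K.indep ht
    have h := hind.affineSpan_eq_top_iff_card_eq_finrank_add_one
    rw [Subtype.range_coe_subtype, finrank_euclideanSpace_fin] at h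
    simpa using h.1 htop
  have hdense : Dense Nᶜ := MeasureTheory.Measure.dense_of_ae
    (μ := MeasureTheory.volume) (MeasureTheory.compl_mem_ae_iff.2 hNnull)
  have hint : (interior (convexHull ℝ (S : Set Plane))).Nonempty :=
    interior_convexHull_nonempty_iff_affineSpan_eq_top.2 (affineSpan_eq_top_of_not_collinear hS)
  have hsub : interior (convexHull ℝ (S : Set Plane)) ∩ Nᶜ ⊆ U := by
    rintro y ⟨hy, hyN⟩
    have hy' := interior_subset hy
    rw [← hK.space_eq, Geometry.SimplicialComplex.mem_space_iff] at hy'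
    obtain ⟨t, ht, hyt⟩ := hy'
    refine Set.mem_biUnion (x := t) ⟨ht, ?_⟩ hyt
    by_contra hcard
    exact hyN (Set.mem_biUnion (x := t) ⟨ht, hcard⟩ (convexHull_subset_affineSpan _ hyt))
  have hxU : x ∈ U := by
    have h1 := subset_closure hx
    rw [← (convex_convexHull ℝ _).closure_interior_eq_closure_of_nonempty_interior hint] at h1
    have h2 := closure_mono (hdense.open_subset_closure_inter isOpen_interior) h1
    rw [closure_closure] at h2
    exact hUclosed.closure_subset_iff.2 hsub h2
  rw [hU] at hxU
  simp only [Set.mem_iUnion] at hxU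
  obtain ⟨t, ⟨ht, hc⟩, hxt⟩ := hxU
  exact ⟨t, ht, hc, hxt⟩

end IsTriangulation

/-- If the closed disk with diameter `ab` contains no further site, then `ab` is an edge of every
Delaunay triangulation. -/
theorem IsDelaunayTriangulation.pair_mem_faces {S : Finset Plane}
    {K : Geometry.SimplicialComplex ℝ Plane} (hK : IsDelaunayTriangulation S K)
    (hS : ¬ Collinear ℝ (S : Set Plane)) {a b : Plane} (ha : a ∈ S) (hb : b ∈ S) (hab : a ≠ b)
    (hdisk : ∀ c ∈ S, c ≠ a → c ≠ b → (dist a b / 2) ^ 2 < dist c (midpoint ℝ a b) ^ 2)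
    [DecidableEq Plane] : {a, b} ∈ K.faces := by
  set m := midpoint ℝ a b with hm
  have hma : dist a m = dist a b / 2 := by
    rw [hm, dist_left_midpoint]; simp; ring
  have hmb : dist b m = dist a b / 2 := by
    rw [hm, dist_right_midpoint]; simp; ring
  have hmS : m ∈ convexHull ℝ (S : Set Plane) :=
    (convex_convexHull ℝ _).midpoint_mem (subset_convexHull ℝ _ ha) (subset_convexHull ℝ _ hb)
  obtain ⟨t, ht, hcard, hmt⟩ := hK.exists_triangle hS hmS
  have hne : Nonempty t := by
    obtain ⟨x, hx⟩ := Geometry.SimplicialComplex.nonempty_of_mem_faces ht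
    exact ⟨⟨x, hx⟩⟩
  obtain ⟨C, ⟨-, hC⟩, -⟩ := (K.indep ht).existsUnique_dist_eq
  have hCt : ∀ v ∈ t, v ∈ C := fun v hv => hC ⟨⟨v, hv⟩, rfl⟩
  have hempty := hK.empty_circumcircle t ht hcard C hCt
  obtain ⟨w, hw0, hw1, hwm⟩ := Finset.mem_convexHull'.1 hmt
  set o := C.center
  -- The squared distances to the circumcenter and to the midpoint differ by an affine function `h`.
  -- It is at least `k` at `a` and `b`, because the circumcircle is empty, and at most `k` at the
  -- vertices of `t`, strictly so at those other than `a` and `b`. Averaging to `m` in both ways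
  -- forces equality, hence zero weight at those other vertices.
  set h : Plane → ℝ := fun v => dist v o ^ 2 - dist v m ^ 2 with hh
  have hform : ∀ v, h v = inner ℝ v ((2 : ℝ) • (m - o)) + (inner ℝ o o - inner ℝ m m) := by
    intro v
    simp only [hh, dist_eq_norm, ← real_inner_self_eq_norm_sq, inner_sub_left, inner_sub_right,
      inner_smul_right, real_inner_comm v]
    ring
  have hsum : ∑ v ∈ t, w v * h v = h m := by
    rw [hform m, ← hwm, sum_inner]
    simp only [hform, mul_add, Finset.sum_add_distrib, ← Finset.sum_mul, hw1, one_mul]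
    rw [hwm]
    simp [inner_smul_left]
  have hmid : h m = (h a + h b) / 2 := by
    rw [hform m, hform a, hform b]
    have : m = (2⁻¹ : ℝ) • (a + b) := by rw [hm, midpoint_eq_smul_add]; simp
    rw [show inner ℝ m ((2 : ℝ) • (m - o)) =
      2⁻¹ * (inner ℝ a ((2 : ℝ) • (m - o)) + inner ℝ b ((2 : ℝ) • (m - o))) by
        conv_lhs => rw [this]
        rw [inner_smul_left, inner_add_left, ← this]; simp]
    ring
  have hR : 0 ≤ C.radius := by
    obtain ⟨x, hx⟩ := hne
    rw [← EuclideanGeometry.mem_sphere.1 (hCt x hx)]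
    exact dist_nonneg
  set k := C.radius ^ 2 - (dist a b / 2) ^ 2 with hk
  have hka : k ≤ h a := by
    have := hempty a ha
    simp only [hh, hk, hma]
    gcongr
  have hkb : k ≤ h b := by
    have := hempty b hb
    simp only [hh, hk, hmb]
    gcongr
  have hkv : ∀ v ∈ t, v ≠ a → v ≠ b → h v < k := by
    intro v hv hva hvb
    have h1 := hdisk v (hK.subset_sites ht hv) hva hvb
    have h2 := EuclideanGeometry.mem_sphere.1 (hCt v hv)
    simp only [hh, hk]
    rw [h2]
    linarith
  have hkv' : ∀ v ∈ t, h v ≤ k := by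
    intro v hv
    have h2 := EuclideanGeometry.mem_sphere.1 (hCt v hv)
    by_cases hva : v = a
    · subst hva; simp only [hh, hk, hma]; rw [h2]
    by_cases hvb : v = b
    · subst hvb; simp only [hh, hk, hmb]; rw [h2]
    · exact (hkv v hv hva hvb).le
  have hzero : ∀ v ∈ t, w v * (k - h v) = 0 := by
    refine (Finset.sum_eq_zero_iff_of_nonneg fun v hv =>
      mul_nonneg (hw0 v hv) (sub_nonneg.2 (hkv' v hv))).1 (le_antisymm ?_
        (Finset.sum_nonneg fun v hv => mul_nonneg (hw0 v hv) (sub_nonneg.2 (hkv' v hv))))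
    simp only [mul_sub, Finset.sum_sub_distrib, ← Finset.sum_mul, hw1, hsum]
    linarith
  have hw : ∀ v ∈ t, v ≠ a → v ≠ b → w v = 0 := by
    intro v hv hva hvb
    exact (mul_eq_zero.1 (hzero v hv)).resolve_right (sub_pos.2 (hkv v hv hva hvb)).ne'
  -- If only one of the two end points were in `t`, all the weight would sit there and `m` would
  -- equal it.
  have hother : ∀ x y : Plane, (∀ v ∈ t, v ≠ x → v ≠ y → w v = 0) → x ∉ t → m = y := by
    intro x y hxy hx
    rw [← hwm, Finset.sum_congr rfl (g := fun v => w v • y), ← Finset.sum_smul, hw1, one_smul]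
    intro v hv
    by_cases hvy : v = y
    · rw [hvy]
    · rw [hxy v hv (fun h => hx (h ▸ hv)) hvy, zero_smul, zero_smul]
  have hat : a ∈ t := by
    by_contra hat
    have := hother a b hw hat
    rw [hm, midpoint_eq_right_iff] at this
    exact hab this
  have hbt : b ∈ t := by
    by_contra hbt
    have := hother b a (fun v hv h1 h2 => hw v hv h2 h1) hbt
    rw [hm, midpoint_eq_left_iff] at this
    exact hab this
  refine K.down_closed ht ?_ ⟨a, by simp⟩
  intro v hv
  rcases Finset.mem_insert.1 hv with rfl | hv
  · exact hat
  · rw [Finset.mem_singleton.1 hv]; exact hbt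

/-- A Euclidean minimum spanning tree is contained in every Delaunay triangulation. -/
theorem IsEuclideanMST.le_edgeGraph {S : Finset Plane} {K : Geometry.SimplicialComplex ℝ Plane}
    {T : SimpleGraph S} (hT : IsEuclideanMST S T) (hK : IsDelaunayTriangulation S K)
    (hS : ¬ Collinear ℝ (S : Set Plane)) : T ≤ edgeGraph S K := by
  classical
  intro a b hab
  refine ⟨hab.ne, ?_⟩
  convert! hK.pair_mem_faces hS a.2 b.2 (fun h => hab.ne (Subtype.ext h)) ?_
  intro c hc hca hcb
  exact hT.dist_midpoint_lt (c := ⟨c, hc⟩) hab (fun h => hca (congrArg Subtype.val h))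
    (fun h => hcb (congrArg Subtype.val h))

/-! ### Ray crossings modulo 2 -/

/-- The signed area of the parallelogram spanned by `b - a` and `p - a` in the coordinates
`ξ`, `η`. -/
def orient (ξ η : Plane →L[ℝ] ℝ) (a b p : Plane) : ℝ :=
  (ξ b - ξ a) * (η p - η a) - (η b - η a) * (ξ p - ξ a)

open Classical in
/-- The indicator of the event that the upward ray from `p` crosses the segment `ab`. -/
noncomputable def crossing (ξ η : Plane →L[ℝ] ℝ) (p a b : Plane) : ZMod 2 :=
  if (ξ a ≤ ξ p ∧ ξ p < ξ b ∧ orient ξ η a b p < 0) ∨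
    (ξ b ≤ ξ p ∧ ξ p < ξ a ∧ orient ξ η b a p < 0) then 1 else 0

open Classical in
/-- The change at `v` of the crossings when `p₀` is moved to `p`. -/
noncomputable def vertexJump (ξ η : Plane →L[ℝ] ℝ) (p₀ p v : Plane) : ZMod 2 :=
  if ξ v = ξ p₀ ∧ η p₀ < η v ∧ ξ p < ξ v then 1 else 0

/-- Sum of a function of pairs along the steps of a walk. -/
def walkSum {V : Type*} {G : SimpleGraph V} {u v : V} (w : G.Walk u v) (F : V → V → ZMod 2) :
    ZMod 2 :=
  (w.darts.map fun d => F d.fst d.snd).sum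

section WalkSum

variable {V : Type*} {G : SimpleGraph V} {u v : V}

@[simp]
theorem walkSum_nil (F : V → V → ZMod 2) : walkSum (SimpleGraph.Walk.nil : G.Walk u u) F = 0 := rfl

@[simp]
theorem walkSum_cons {x : V} (h : G.Adj u v) (w : G.Walk v x) (F : V → V → ZMod 2) :
    walkSum (SimpleGraph.Walk.cons h w) F = F u v + walkSum w F := by
  simp [walkSum]

theorem walkSum_congr (w : G.Walk u v) {F F' : V → V → ZMod 2}
    (h : ∀ a b, G.Adj a b → F a b = F' a b) : walkSum w F = walkSum w F' := by
  induction w with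
  | nil => rfl
  | cons hadj _ ih => rw [walkSum_cons, walkSum_cons, ih, h _ _ hadj]

theorem walkSum_add (w : G.Walk u v) (F F' : V → V → ZMod 2) :
    walkSum w (fun a b => F a b + F' a b) = walkSum w F + walkSum w F' := by
  induction w with
  | nil => simp
  | cons hadj _ ih => rw [walkSum_cons, walkSum_cons, walkSum_cons, ih]; ring

/-- Inner vertices contribute twice and cancel modulo 2. On a closed walk everything cancels, which
disposes of the vertex jumps. -/
theorem walkSum_endpoints (w : G.Walk u v) (d : V → ZMod 2) :
    walkSum w (fun a b => d a + d b) = d u + d v := by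
  induction w with
  | nil => simp [CharTwo.add_self_eq_zero]
  | @cons x y z hadj _ ih =>
    rw [walkSum_cons, ih]
    linear_combination CharTwo.add_self_eq_zero (d y)

theorem walkSum_ite [DecidableEq V] (w : G.Walk u v) (e : Sym2 V) (x : ZMod 2) (F : V → V → ZMod 2) :
    walkSum w (fun a b => if s(a, b) = e then x else F a b) =
      walkSum w (fun a b => if s(a, b) = e then 0 else F a b) + w.edges.count e * x := by
  induction w with
  | nil => simp
  | @cons a b c hadj w ih =>
    rw [walkSum_cons, walkSum_cons, ih, SimpleGraph.Walk.edges_cons, List.count_cons]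
    by_cases h : s(a, b) = e
    · simp [h]; ring
    · simp [h]; ring

end WalkSum

section Crossing

variable {ξ η : Plane →L[ℝ] ℝ} {a b p p₀ : Plane}

theorem continuous_orient (ξ η : Plane →L[ℝ] ℝ) (a b : Plane) :
    Continuous (orient ξ η a b) := by
  unfold orient; fun_prop

theorem crossing_comm (ξ η : Plane →L[ℝ] ℝ) (p a b : Plane) :
    crossing ξ η p a b = crossing ξ η p b a := by
  unfold crossing; simp only [or_comm]

theorem crossing_eq_one (h₁ : ξ a ≤ ξ p) (h₂ : ξ p < ξ b) (h₃ : orient ξ η a b p < 0) :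
    crossing ξ η p a b = 1 := if_pos (Or.inl ⟨h₁, h₂, h₃⟩)

theorem crossing_eq_zero (hab : ξ a < ξ b)
    (h : ξ p < ξ a ∨ ξ b ≤ ξ p ∨ 0 ≤ orient ξ η a b p) : crossing ξ η p a b = 0 := by
  refine if_neg ?_
  rintro (⟨h₁, h₂, h₃⟩ | ⟨h₁, h₂, h₃⟩)
  · rcases h with h | h | h <;> linarith
  · linarith

theorem vertexJump_of_ne (h : ξ a ≠ ξ p₀) : vertexJump ξ η p₀ p a = 0 :=
  if_neg fun h' => h h'.1

theorem vertexJump_of_le (h : η a ≤ η p₀) : vertexJump ξ η p₀ p a = 0 :=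
  if_neg fun h' => absurd h'.2.1 (not_lt.2 h)

/-- A point over the open interval between `a` and `b` that is on the line `ab` is on the open
segment. -/
theorem mem_segment_of_orient_eq_zero (hinj : ∀ p q, ξ p = ξ q → η p = η q → p = q)
    (h₁ : ξ a < ξ p) (h₂ : ξ p < ξ b) (h : orient ξ η a b p = 0) : p ∈ segment ℝ a b := by
  have hab : 0 < ξ b - ξ a := by linarith
  rw [segment_eq_image']
  refine ⟨(ξ p - ξ a) / (ξ b - ξ a), ⟨by apply div_nonneg <;> linarith, ?_⟩, hinj _ _ ?_ ?_⟩
  · rw [div_le_one hab]; linarith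
  · simp only [map_add, map_smul, map_sub, smul_eq_mul]; field_simp; ring
  · unfold orient at h
    simp only [map_add, map_smul, map_sub, smul_eq_mul]; field_simp; linarith

/-- An edge counts over its left end but not over its right end. Moving strictly to the left of an
end point that was directly above thus loses a crossing in the first case and gains one in the
second: modulo 2 the same flip, depending on the vertex alone. -/
theorem eventually_crossing_of_lt (hinj : ∀ p q, ξ p = ξ q → η p = η q → p = q)
    (hab : ξ a < ξ b) (hp : p₀ ∉ segment ℝ a b) :
    ∀ᶠ p in 𝓝 p₀, crossing ξ η p a b =
      crossing ξ η p₀ a b + (vertexJump ξ η p₀ p a + vertexJump ξ η p₀ p b) := by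
  have cξ := ξ.continuous.tendsto p₀
  have co := (continuous_orient ξ η a b).tendsto p₀
  have ne_of : ∀ v, ξ v = ξ p₀ → v ∈ segment ℝ a b → η v ≠ η p₀ := fun v h hv h' =>
    hp (hinj _ _ h h' ▸ hv)
  rcases lt_trichotomy (ξ p₀) (ξ a) with h | h | h
  · filter_upwards [cξ.eventually_lt_const h] with p hpa
    rw [crossing_eq_zero hab (Or.inl hpa), crossing_eq_zero hab (Or.inl h),
      vertexJump_of_ne h.ne', vertexJump_of_ne (h.trans hab).ne']
    rfl
  · have hval : orient ξ η a b p₀ = (ξ b - ξ a) * (η p₀ - η a) := by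
      unfold orient; rw [h]; ring
    have hb : ∀ p, vertexJump ξ η p₀ p b = 0 := fun p =>
      vertexJump_of_ne (by rw [h]; exact hab.ne')
    rcases lt_or_gt_of_ne (ne_of a h.symm (left_mem_segment ℝ a b)) with h' | h'
    · have ho : 0 < orient ξ η a b p₀ := by
        rw [hval]; exact mul_pos (sub_pos.2 hab) (sub_pos.2 h')
      filter_upwards [co.eventually_const_lt ho] with p hpo
      rw [crossing_eq_zero hab (Or.inr (Or.inr hpo.le)),
        crossing_eq_zero hab (Or.inr (Or.inr ho.le)), hb, vertexJump_of_le h'.le]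
      rfl
    · have ho : orient ξ η a b p₀ < 0 := by
        rw [hval]; exact mul_neg_of_pos_of_neg (sub_pos.2 hab) (sub_neg.2 h')
      filter_upwards [co.eventually_lt_const ho, cξ.eventually_lt_const (h ▸ hab)] with p hpo hpb
      rw [crossing_eq_one h.symm.le (h ▸ hab) ho, hb]
      by_cases hpa : ξ p < ξ a
      · rw [crossing_eq_zero hab (Or.inl hpa), vertexJump, if_pos ⟨h.symm, h', hpa⟩]
        rfl
      · rw [crossing_eq_one (not_lt.1 hpa) hpb hpo, vertexJump, if_neg fun h => hpa h.2.2]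
        rfl
  have ha : ∀ p, vertexJump ξ η p₀ p a = 0 := fun p => vertexJump_of_ne h.ne
  rcases lt_trichotomy (ξ p₀) (ξ b) with hb | hb | hb
  · have hb' : ∀ p, vertexJump ξ η p₀ p b = 0 := fun p => vertexJump_of_ne hb.ne'
    rcases lt_or_gt_of_ne (fun h0 => hp (mem_segment_of_orient_eq_zero hinj h hb h0)) with ho | ho
    · filter_upwards [cξ.eventually_const_lt h, cξ.eventually_lt_const hb,
        co.eventually_lt_const ho] with p h1 h2 h3
      rw [crossing_eq_one h1.le h2 h3, crossing_eq_one h.le hb ho, ha, hb']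
      rfl
    · filter_upwards [co.eventually_const_lt ho] with p h3
      rw [crossing_eq_zero hab (Or.inr (Or.inr h3.le)),
        crossing_eq_zero hab (Or.inr (Or.inr ho.le)), ha, hb']
      rfl
  · have hval : orient ξ η a b p₀ = (ξ b - ξ a) * (η p₀ - η b) := by
      unfold orient; rw [hb]; ring
    rcases lt_or_gt_of_ne (ne_of b hb.symm (right_mem_segment ℝ a b)) with h' | h'
    · have ho : 0 < orient ξ η a b p₀ := by
        rw [hval]; exact mul_pos (sub_pos.2 hab) (sub_pos.2 h')
      filter_upwards [co.eventually_const_lt ho] with p hpo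
      rw [crossing_eq_zero hab (Or.inr (Or.inr hpo.le)),
        crossing_eq_zero hab (Or.inr (Or.inr ho.le)), ha, vertexJump_of_le h'.le]
      rfl
    · have ho : orient ξ η a b p₀ < 0 := by
        rw [hval]; exact mul_neg_of_pos_of_neg (sub_pos.2 hab) (sub_neg.2 h')
      filter_upwards [co.eventually_lt_const ho, cξ.eventually_const_lt h] with p hpo hpa
      rw [crossing_eq_zero hab (Or.inr (Or.inl hb.symm.le)), ha]
      by_cases hpb : ξ p < ξ b
      · rw [crossing_eq_one hpa.le hpb hpo, vertexJump, if_pos ⟨hb.symm, h', hpb⟩]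
        rfl
      · rw [crossing_eq_zero hab (Or.inr (Or.inl (not_lt.1 hpb))), vertexJump,
          if_neg fun h => hpb h.2.2]
        rfl
  · filter_upwards [cξ.eventually_const_lt hb] with p hpb
    rw [crossing_eq_zero hab (Or.inr (Or.inl hpb.le)), crossing_eq_zero hab (Or.inr (Or.inl hb.le)),
      ha, vertexJump_of_ne hb.ne]
    rfl

/-- Near a point off the segment `ab` the crossings of `ab` change only through the jumps at the
end points. -/
theorem eventually_crossing (hinj : ∀ p q, ξ p = ξ q → η p = η q → p = q)
    (hab : ξ a ≠ ξ b) (hp : p₀ ∉ segment ℝ a b) :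
    ∀ᶠ p in 𝓝 p₀, crossing ξ η p a b =
      crossing ξ η p₀ a b + (vertexJump ξ η p₀ p a + vertexJump ξ η p₀ p b) := by
  rcases lt_or_gt_of_ne hab with h | h
  · exact eventually_crossing_of_lt hinj h hp
  · rw [segment_symm] at hp
    filter_upwards [eventually_crossing_of_lt hinj h hp] with p hp
    rw [crossing_comm, hp, crossing_comm, add_comm (vertexJump ξ η p₀ p b)]

-- Neither end is above the midpoint, so both jumps vanish; they are kept so that the formula has
-- the same shape as for the other edges.
open Classical in
theorem eventually_crossing_midpoint (hab : ξ a < ξ b) :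
    ∀ᶠ p in 𝓝 (midpoint ℝ a b), crossing ξ η p a b =
      (if orient ξ η a b p < 0 then 1 else 0) +
      (vertexJump ξ η (midpoint ℝ a b) p a + vertexJump ξ η (midpoint ℝ a b) p b) := by
  have hm : ξ (midpoint ℝ a b) = (ξ a + ξ b) / 2 := by
    rw [midpoint_eq_smul_add, map_smul, map_add]; simp; ring
  have cξ := ξ.continuous.tendsto (midpoint ℝ a b)
  filter_upwards [cξ.eventually_const_lt (u := ξ a) (by rw [hm]; linarith),
    cξ.eventually_lt_const (u := ξ b) (by rw [hm]; linarith)] with p h1 h2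
  rw [vertexJump_of_ne (by rw [hm]; linarith), vertexJump_of_ne (by rw [hm]; linarith)]
  by_cases h : orient ξ η a b p < 0
  · rw [crossing_eq_one h1.le h2 h, if_pos h]; rfl
  · rw [crossing_eq_zero hab (Or.inr (Or.inr (not_lt.1 h))), if_neg h]; rfl

end Crossing

/-! ### Parity of a closed walk around a point -/

section Parity

variable {S : Finset Plane} {G : SimpleGraph S} {ξ η : Plane →L[ℝ] ℝ} {u : S}

/-- The parity of the number of steps of a walk that the upward ray from `p` crosses. -/
noncomputable def parity (ξ η : Plane →L[ℝ] ℝ) (w : G.Walk u u) (p : Plane) : ZMod 2 :=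
  walkSum w fun a b => crossing ξ η p a b

theorem eventually_parity_eq (hinj : ∀ p q, ξ p = ξ q → η p = η q → p = q)
    (hS : Set.InjOn ξ (S : Set Plane)) (w : G.Walk u u) {p₀ : Plane}
    (hp : ∀ a b : S, G.Adj a b → p₀ ∉ segment ℝ (a : Plane) b) :
    ∀ᶠ p in 𝓝 p₀, parity ξ η w p = parity ξ η w p₀ := by
  have h : ∀ᶠ p in 𝓝 p₀, ∀ a b : S, G.Adj a b → crossing ξ η p a b =
      crossing ξ η p₀ a b + (vertexJump ξ η p₀ p a + vertexJump ξ η p₀ p b) := by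
    refine eventually_all.2 fun a => eventually_all.2 fun b => eventually_imp_distrib_left.2
      fun hab => eventually_crossing hinj (fun h => hab.ne (Subtype.ext (hS a.2 b.2 h))) (hp a b hab)
  filter_upwards [h] with p hp
  unfold parity
  rw [walkSum_congr w hp, walkSum_add,
    walkSum_endpoints w (fun v : S => vertexJump ξ η p₀ p v), CharTwo.add_self_eq_zero, add_zero]

theorem parity_eq_of_isPreconnected (hinj : ∀ p q, ξ p = ξ q → η p = η q → p = q)
    (hS : Set.InjOn ξ (S : Set Plane)) (w : G.Walk u u) {U : Set Plane} (hU : IsPreconnected U)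
    (hUG : ∀ p ∈ U, ∀ a b : S, G.Adj a b → p ∉ segment ℝ (a : Plane) b) {p q : Plane}
    (hp : p ∈ U) (hq : q ∈ U) : parity ξ η w p = parity ξ η w q := by
  let _ : TopologicalSpace (ZMod 2) := ⊥
  have : DiscreteTopology (ZMod 2) := ⟨rfl⟩
  refine hU.constant (fun x hx => ContinuousAt.continuousWithinAt ?_) hp hq
  exact tendsto_const_nhds.congr'
    ((eventually_parity_eq hinj hS w (hUG x hx)).mono fun _ h => h.symm)

/-- The ray from `p` away from the site `c` never meets the hull, since otherwise convexity would
put `p` in it. As `ξ c ≠ ξ p`, the ray eventually passes all sites on the left or on the right,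
where nothing is crossed. -/
theorem parity_eq_zero_of_notMem_convexHull (hinj : ∀ p q, ξ p = ξ q → η p = η q → p = q)
    (hS : Set.InjOn ξ (S : Set Plane)) (w : G.Walk u u) {p c : Plane}
    (hp : p ∉ convexHull ℝ (S : Set Plane)) (hc : c ∈ S) (hpc : ξ c ≠ ξ p) :
    parity ξ η w p = 0 := by
  set r : ℝ → Plane := fun s => p + s • (p - c) with hr
  have hrc : Continuous r := by fun_prop
  have hU : IsPreconnected (r '' Set.Ici 0) := isPreconnected_Ici.image r hrc.continuousOn
  have hout : ∀ s, 0 ≤ s → r s ∉ convexHull ℝ (S : Set Plane) := by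
    intro s hs hmem
    apply hp
    have h := (convex_convexHull ℝ (S : Set Plane)) hmem (subset_convexHull ℝ _ hc)
      (a := 1 / (1 + s)) (b := s / (1 + s)) (by positivity) (by positivity) (by field_simp)
    have h1 : (1 + s) ≠ 0 := by positivity
    convert! h using 1
    rw [hr, show ((1 : ℝ) / (1 + s)) • (p + s • (p - c)) + (s / (1 + s)) • c =
      ((1 + s)⁻¹ * (1 + s)) • p by module, inv_mul_cancel₀ h1, one_smul]
  have hseg : ∀ q ∈ r '' Set.Ici 0, ∀ a b : S, G.Adj a b → q ∉ segment ℝ (a : Plane) b := by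
    rintro _ ⟨s, hs, rfl⟩ a b - hq
    exact hout s hs (segment_subset_convexHull a.2 b.2 hq)
  have hfar : ∃ s, 0 ≤ s ∧ ((∀ v ∈ S, ξ v ≤ ξ (r s)) ∨ ∀ v ∈ S, ξ (r s) < ξ v) := by
    have hξr : ∀ s, ξ (r s) = ξ p + s * (ξ p - ξ c) := fun s => by simp [hr]
    rcases lt_or_gt_of_ne hpc with h | h
    · have ht : Tendsto (fun s => ξ (r s)) atTop atTop := by
        simp only [hξr]
        exact tendsto_atTop_add_const_left _ _ (tendsto_id.atTop_mul_const (sub_pos.2 h))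
      have he : ∀ᶠ s in atTop, ∀ v ∈ S, ξ v ≤ ξ (r s) :=
        (S.eventually_all).2 fun v _ => ht.eventually_ge_atTop _
      obtain ⟨s, h1, h2⟩ := (he.and (eventually_ge_atTop 0)).exists
      exact ⟨s, h2, Or.inl h1⟩
    · have ht : Tendsto (fun s => ξ (r s)) atTop atBot := by
        simp only [hξr]
        exact tendsto_atBot_add_const_left _ _
          (tendsto_id.atTop_mul_const_of_neg (sub_neg.2 h))
      have he : ∀ᶠ s in atTop, ∀ v ∈ S, ξ (r s) < ξ v :=
        (S.eventually_all).2 fun v _ => ht.eventually_lt_atBot _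
      obtain ⟨s, h1, h2⟩ := (he.and (eventually_ge_atTop 0)).exists
      exact ⟨s, h2, Or.inr h1⟩
  obtain ⟨s, hs, hfar⟩ := hfar
  have hps : parity ξ η w p = parity ξ η w (r s) :=
    parity_eq_of_isPreconnected hinj hS w hU hseg ⟨0, Set.self_mem_Ici, by simp [hr]⟩ ⟨s, hs, rfl⟩
  rw [hps, parity, walkSum_congr w (F' := fun _ _ => 0 + 0), walkSum_endpoints w fun _ => 0,
    add_zero]
  intro a b _
  rw [add_zero]
  refine if_neg ?_
  rintro (⟨h1, h2, -⟩ | ⟨h1, h2, -⟩) <;> rcases hfar with hf | hf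
  · exact absurd h2 (not_lt.2 (hf b b.2))
  · exact absurd h1 (not_le.2 (hf a a.2))
  · exact absurd h2 (not_lt.2 (hf a a.2))
  · exact absurd h1 (not_le.2 (hf b b.2))

open Classical in
/-- Across an edge, the parity changes by the multiplicity of the edge in the walk. -/
theorem exists_eventually_parity_eq (hinj : ∀ p q, ξ p = ξ q → η p = η q → p = q)
    (hS : Set.InjOn ξ (S : Set Plane)) (w : G.Walk u u) {a b : S} (hab : ξ a < ξ b)
    (hq : ∀ c d : S, G.Adj c d → midpoint ℝ (a : Plane) b ∈ segment ℝ (c : Plane) d →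
      s(c, d) = s(a, b)) :
    ∃ B : ZMod 2, ∀ᶠ p in 𝓝 (midpoint ℝ (a : Plane) b), parity ξ η w p =
      B + w.edges.count s(a, b) * if orient ξ η a b p < 0 then 1 else 0 := by
  set q := midpoint ℝ (a : Plane) b
  -- `B` collects the steps along all other edges, with their crossings frozen at `q`.
  refine ⟨walkSum w fun c d => if s(c, d) = s(a, b) then 0 else crossing ξ η q c d, ?_⟩
  have h : ∀ᶠ p in 𝓝 q, ∀ c d : S, G.Adj c d → crossing ξ η p c d =
      (if s(c, d) = s(a, b) then (if orient ξ η a b p < 0 then 1 else 0) else crossing ξ η q c d) +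
        (vertexJump ξ η q p c + vertexJump ξ η q p d) := by
    refine eventually_all.2 fun c => eventually_all.2 fun d => eventually_imp_distrib_left.2
      fun hcd => ?_
    by_cases he : s(c, d) = s(a, b)
    · simp only [he, if_true]
      rcases Sym2.eq_iff.1 he with ⟨rfl, rfl⟩ | ⟨rfl, rfl⟩
      · exact eventually_crossing_midpoint hab
      · filter_upwards [eventually_crossing_midpoint (η := η) hab] with p hp
        rw [crossing_comm, hp, add_comm (vertexJump ξ η q p c)]
    · simp only [he, if_false]
      exact eventually_crossing hinj (fun h => hcd.ne (Subtype.ext (hS c.2 d.2 h)))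
        fun h => he (hq c d hcd h)
  filter_upwards [h] with p hp
  unfold parity
  rw [walkSum_congr w hp, walkSum_add,
    walkSum_endpoints w (fun v : S => vertexJump ξ η q p v), CharTwo.add_self_eq_zero, add_zero]
  exact walkSum_ite w s(a, b) _ fun c d => crossing ξ η q c d

end Parity

/-! ### Open cells and the two sides of an edge -/

/-- The points with positive weights with respect to all vertices of `t`. -/
def openCell (t : Finset Plane) : Set Plane :=
  {p | ∃ w : Plane → ℝ, (∀ v ∈ t, 0 < w v) ∧ ∑ v ∈ t, w v = 1 ∧ ∑ v ∈ t, w v • v = p}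

/-- The barycenter of a finite set of points. -/
noncomputable def barycenter (t : Finset Plane) : Plane := ∑ v ∈ t, (t.card : ℝ)⁻¹ • v

theorem convex_openCell (t : Finset Plane) : Convex ℝ (openCell t) := by
  rw [convex_iff_forall_pos]
  rintro p ⟨w, hw, hw1, rfl⟩ q ⟨w', hw', hw1', rfl⟩ x y hx hy hxy
  refine ⟨fun v => x * w v + y * w' v, fun v hv => ?_, ?_, ?_⟩
  · have := hw v hv
    have := hw' v hv
    positivity
  · rw [Finset.sum_add_distrib, ← Finset.mul_sum, ← Finset.mul_sum, hw1, hw1', mul_one, mul_one,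
      hxy]
  · simp only [add_smul, mul_smul, Finset.sum_add_distrib, Finset.smul_sum]

theorem openCell_subset_convexHull (t : Finset Plane) :
    openCell t ⊆ convexHull ℝ (t : Set Plane) := by
  rintro p ⟨w, hw, hw1, hwp⟩
  exact Finset.mem_convexHull'.2 ⟨w, fun v hv => (hw v hv).le, hw1, hwp⟩

theorem barycenter_mem_openCell {t : Finset Plane} (ht : t.Nonempty) :
    barycenter t ∈ openCell t := by
  have h : 0 < (t.card : ℝ) := by exact_mod_cast ht.card_pos
  refine ⟨fun _ => (t.card : ℝ)⁻¹, fun v _ => by positivity, ?_, rfl⟩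
  rw [Finset.sum_const, nsmul_eq_mul, mul_inv_cancel₀ h.ne']

open Classical in
theorem midpoint_mem_openCell {a b : Plane} (hab : a ≠ b) :
    midpoint ℝ a b ∈ openCell {a, b} := by
  refine ⟨fun _ => 2⁻¹, fun _ _ => by positivity, ?_, ?_⟩
  · rw [Finset.sum_pair hab]; norm_num
  · rw [Finset.sum_pair hab, midpoint_eq_smul_add]; simp

/-- A face that meets the open cell of another face contains it. -/
theorem Geometry.SimplicialComplex.subset_of_mem_openCell
    {K : Geometry.SimplicialComplex ℝ Plane} {s t : Finset Plane} (hs : s ∈ K.faces)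
    (ht : t ∈ K.faces) {p : Plane} (hp : p ∈ openCell s) (hpt : p ∈ convexHull ℝ (t : Set Plane)) :
    s ⊆ t := by
  classical
  have h := K.inter_subset_convexHull hs ht ⟨openCell_subset_convexHull s hp, hpt⟩
  rw [← Finset.coe_inter] at h
  obtain ⟨w', hw0', hw1', hwp'⟩ := Finset.mem_convexHull'.1 h
  obtain ⟨w, hw0, hw1, hwp⟩ := hp
  -- Weights of `p` on the common face, extended by zero to `s`. By affine independence they agree
  -- with the positive weights `w`, so no vertex of `s` is missing from `t`.
  set z : Plane → ℝ := fun v => if v ∈ s ∩ t then w' v else 0 with hz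
  have hz1 : ∑ v ∈ s, z v = 1 := by
    rw [← hw1', ← Finset.sum_subset (Finset.inter_subset_left (s₂ := t)) fun v _ hv => if_neg hv]
    exact Finset.sum_congr rfl fun v hv => if_pos hv
  have hzp : ∑ v ∈ s, z v • v = p := by
    rw [← hwp', ← Finset.sum_subset (Finset.inter_subset_left (s₂ := t)) fun v _ hv => by
      rw [hz]; simp only [if_neg hv, zero_smul]]
    exact Finset.sum_congr rfl fun v hv => by rw [hz]; simp only [if_pos hv]
  have hind := (affineIndependent_iff.1 (K.indep hs)) Finset.univ (fun v : s => w v - z v)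
    (by rw [Finset.sum_coe_sort s fun v => w v - z v, Finset.sum_sub_distrib, hw1, hz1, sub_self])
    (by
      rw [Finset.sum_coe_sort s fun v => (w v - z v) • v]
      simp only [sub_smul, Finset.sum_sub_distrib, hwp, hzp, sub_self])
  intro v hv
  by_contra hvt
  have h1 := hind ⟨v, hv⟩ (Finset.mem_univ _)
  have h2 : z v = 0 := if_neg fun h => hvt (Finset.mem_inter.1 h).2
  simp only [h2, sub_zero] at h1
  exact (hw0 v hv).ne' h1

section Sides

variable {ξ η : Plane →L[ℝ] ℝ} {a b c p : Plane}

theorem orient_left (ξ η : Plane →L[ℝ] ℝ) (a b : Plane) : orient ξ η a b a = 0 := by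
  unfold orient; ring

theorem orient_right (ξ η : Plane →L[ℝ] ℝ) (a b : Plane) : orient ξ η a b b = 0 := by
  unfold orient; ring

theorem orient_midpoint (ξ η : Plane →L[ℝ] ℝ) (a b : Plane) :
    orient ξ η a b (midpoint ℝ a b) = 0 := by
  unfold orient
  rw [midpoint_eq_smul_add]
  simp only [map_smul, map_add, smul_eq_mul, invOf_eq_inv]
  ring

theorem orient_sum (ξ η : Plane →L[ℝ] ℝ) (a b : Plane) {t : Finset Plane} {w : Plane → ℝ}
    (hw : ∑ v ∈ t, w v = 1) :
    orient ξ η a b (∑ v ∈ t, w v • v) = ∑ v ∈ t, w v * orient ξ η a b v := by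
  unfold orient
  simp only [map_sum, map_smul, smul_eq_mul]
  have h : ∀ v, w v * ((ξ b - ξ a) * (η v - η a) - (η b - η a) * (ξ v - ξ a)) =
      (ξ b - ξ a) * (w v * η v) - (η b - η a) * (w v * ξ v) -
        ((ξ b - ξ a) * η a - (η b - η a) * ξ a) * w v := fun v => by ring
  simp only [h, Finset.sum_sub_distrib, ← Finset.mul_sum, hw]
  ring

open Classical in
/-- Near the midpoint of `ab`, the points on the same side as `c` are in the open triangle
`abc`. -/
theorem eventually_mem_openCell (hinj : ∀ p q, ξ p = ξ q → η p = η q → p = q)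
    (hab : ξ a < ξ b) {σ : ℝ} (hc : 0 < σ * orient ξ η a b c) :
    ∀ᶠ p in 𝓝 (midpoint ℝ a b), 0 < σ * orient ξ η a b p → p ∈ openCell {a, b, c} := by
  have hba : ξ b - ξ a ≠ 0 := (sub_pos.2 hab).ne'
  have hoc : orient ξ η a b c ≠ 0 := fun h => by rw [h, mul_zero] at hc; exact lt_irrefl _ hc
  have hσ : σ ≠ 0 := fun h => by rw [h, zero_mul] at hc; exact lt_irrefl _ hc
  have hca : a ≠ c := fun h => hoc (h ▸ orient_left ξ η a b)
  have hcb : b ≠ c := fun h => hoc (h ▸ orient_right ξ η a b)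
  have hab' : a ≠ b := fun h => hab.ne (congrArg ξ h)
  set q := midpoint ℝ a b with hq
  have hqe : q = (2⁻¹ : ℝ) • (a + b) := by rw [hq, midpoint_eq_smul_add]; simp
  have hξq : ξ q = (ξ a + ξ b) / 2 := by rw [hqe, map_smul, map_add, smul_eq_mul]; ring
  have hηq : η q = (η a + η b) / 2 := by rw [hqe, map_smul, map_add, smul_eq_mul]; ring
  -- The barycentric coordinates of `p` are `(1 - k) / 2 - l`, `(1 - k) / 2 + l` and `k`. The first
  -- two equal `1 / 2` at the midpoint, so they stay positive nearby; `k` is positive on the side of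
  -- `c`.
  set k : Plane → ℝ := fun p => orient ξ η a b p / orient ξ η a b c with hk
  set l : Plane → ℝ := fun p => (ξ p - ξ q - k p * (ξ c - ξ q)) / (ξ b - ξ a) with hl
  have hkc : Continuous k := (continuous_orient ξ η a b).div_const _
  have hlc : Continuous l := by fun_prop
  have hkq : k q = 0 := by rw [hk]; simp only [hq, orient_midpoint, zero_div]
  have hlq : l q = 0 := by rw [hl]; simp only [hkq]; simp
  have h1 : ∀ᶠ p in 𝓝 q, 0 < (1 - k p) / 2 - l p :=
    (((continuous_const.sub hkc).div_const 2).sub hlc).continuousAt.eventually_const_lt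
      (by simp [hkq, hlq])
  have h2 : ∀ᶠ p in 𝓝 q, 0 < (1 - k p) / 2 + l p :=
    (((continuous_const.sub hkc).div_const 2).add hlc).continuousAt.eventually_const_lt
      (by simp [hkq, hlq])
  filter_upwards [h1, h2] with p h1 h2 hp
  have hkp : 0 < k p := by
    have : k p = (σ * orient ξ η a b p) / (σ * orient ξ η a b c) := by
      rw [hk]; simp only; rw [mul_div_mul_left _ _ hσ]
    rw [this]; exact div_pos hp hc
  refine ⟨fun v => if v = a then (1 - k p) / 2 - l p else if v = b then (1 - k p) / 2 + l p
    else k p, ?_, ?_, ?_⟩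
  · intro v _
    dsimp only
    split_ifs <;> assumption
  · rw [Finset.sum_insert (by simp [hab', hca]), Finset.sum_pair hcb]
    simp only [if_true, hab'.symm, hca.symm, hcb.symm, if_false]
    ring
  · rw [Finset.sum_insert (by simp [hab', hca]), Finset.sum_pair hcb]
    simp only [if_true, hab'.symm, hca.symm, hcb.symm, if_false]
    have hle : l p * (ξ b - ξ a) = ξ p - ξ q - k p * (ξ c - ξ q) := div_mul_cancel₀ _ hba
    have hke : k p * orient ξ η a b c = orient ξ η a b p := div_mul_cancel₀ _ hoc
    rw [hξq] at hle
    have hξ : ((1 - k p) / 2 - l p) * ξ a + (((1 - k p) / 2 + l p) * ξ b + k p * ξ c) = ξ p := by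
      linear_combination hle
    apply hinj
    · simpa only [map_add, map_smul, smul_eq_mul] using hξ
    · simp only [map_add, map_smul, smul_eq_mul]
      apply mul_left_cancel₀ hba
      unfold orient at hke
      linear_combination hke + (η b - η a) * hξ

/-- Going from the midpoint towards `z`, the orientation grows linearly from zero. -/
theorem frequently_orient_pos {σ : ℝ} {z : Plane} (hz : 0 < σ * orient ξ η a b z) :
    ∃ᶠ p in 𝓝 (midpoint ℝ a b), 0 < σ * orient ξ η a b p := by
  set q := midpoint ℝ a b with hq
  have hr : Tendsto (fun s : ℝ => q + s • (z - q)) (𝓝[>] 0) (𝓝 q) := by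
    have : Continuous (fun s : ℝ => q + s • (z - q)) := by fun_prop
    have := (this.tendsto 0).mono_left (nhdsWithin_le_nhds (s := Set.Ioi 0))
    simpa using this
  refine hr.frequently (Eventually.frequently ?_)
  filter_upwards [self_mem_nhdsWithin] with s hs
  have h0 := orient_midpoint ξ η a b
  have : orient ξ η a b (q + s • (z - q)) = s * orient ξ η a b z := by
    rw [← hq] at h0
    unfold orient at h0 ⊢
    simp only [map_add, map_smul, map_sub, smul_eq_mul]
    linear_combination (1 - s) * h0
  rw [this, mul_left_comm]
  exact mul_pos hs hz

end Sides

/-! ### Triangles at an edge -/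

open Classical in
/-- The triangles of a complex with vertices in `S`. -/
noncomputable def triangles (S : Finset Plane) (K : Geometry.SimplicialComplex ℝ Plane) :
    Finset (Finset Plane) :=
  S.powerset.filter fun t => t ∈ K.faces ∧ t.card = 3

section Triangles

variable {S : Finset Plane} {K : Geometry.SimplicialComplex ℝ Plane} {ξ η : Plane →L[ℝ] ℝ}

theorem IsTriangulation.mem_triangles (hK : IsTriangulation S K) {t : Finset Plane} :
    t ∈ triangles S K ↔ t ∈ K.faces ∧ t.card = 3 := by
  classical
  rw [triangles, Finset.mem_filter, Finset.mem_powerset]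
  exact ⟨fun h => h.2, fun h => ⟨hK.subset_sites h.1, h⟩⟩

open Classical in
theorem Finset.eq_insert_insert_of_card_eq_three {t : Finset Plane} (ht : t.card = 3)
    {a b c : Plane} (ha : a ∈ t) (hb : b ∈ t) (hc : c ∈ t) (hab : a ≠ b) (hac : a ≠ c)
    (hbc : b ≠ c) : t = {a, b, c} := by
  symm
  apply Finset.eq_of_subset_of_card_le
  · simp [Finset.insert_subset_iff, ha, hb, hc]
  · rw [ht, Finset.card_eq_three.2 ⟨a, b, c, hab, hac, hbc, rfl⟩]

/-- A triangle has no vertex on the line through two others. -/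
theorem IsTriangulation.orient_ne_zero (hK : IsTriangulation S K)
    (hinj : ∀ p q, ξ p = ξ q → η p = η q → p = q) {t : Finset Plane} (ht : t ∈ triangles S K)
    {a b c : Plane} (ha : a ∈ t) (hb : b ∈ t) (hc : c ∈ t) (hξ : ξ a < ξ b) (hac : a ≠ c)
    (hbc : b ≠ c) : orient ξ η a b c ≠ 0 := by
  classical
  intro h0
  obtain ⟨htK, hcard⟩ := hK.mem_triangles.1 ht
  have hab : a ≠ b := fun h => hξ.ne (congrArg ξ h)
  have hind := K.indep htK
  have ht3 := Finset.eq_insert_insert_of_card_eq_three hcard ha hb hc hab hac hbc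
  have hcol : Collinear ℝ (t : Set Plane) := by
    rw [ht3]
    rw [collinear_iff_of_mem (p₀ := a) (by simp)]
    refine ⟨b - a, ?_⟩
    intro p hp
    simp only [Finset.coe_insert, Finset.coe_singleton, Set.mem_insert_iff,
      Set.mem_singleton_iff] at hp
    have hba : ξ b - ξ a ≠ 0 := (sub_pos.2 hξ).ne'
    rcases hp with rfl | rfl | rfl
    · exact ⟨0, by simp⟩
    · exact ⟨1, by simp⟩
    · refine ⟨(ξ p - ξ a) / (ξ b - ξ a), hinj _ _ ?_ ?_⟩
      · simp only [vadd_eq_add, map_add, map_smul, map_sub, smul_eq_mul]; field_simp; ring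
      · unfold orient at h0
        simp only [vadd_eq_add, map_add, map_smul, map_sub, smul_eq_mul]; field_simp; linarith
  have h2 := collinear_iff_finrank_le_one.1 hcol
  have h3 := hind.finrank_vectorSpan (n := 2) (by rw [Fintype.card_coe, hcard])
  rw [Subtype.range_coe_subtype] at h3
  have : {x | x ∈ t} = (t : Set Plane) := rfl
  rw [this] at h3
  omega

open Classical in
theorem IsTriangulation.eventually_mem_openCell (hK : IsTriangulation S K)
    (hinj : ∀ p q, ξ p = ξ q → η p = η q → p = q) {t : Finset Plane} (ht : t ∈ triangles S K)
    {a b c : Plane} (hξ : ξ a < ξ b) (ha : a ∈ t) (hb : b ∈ t) (hc : c ∈ t) {σ : ℝ}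
    (hσ : 0 < σ * orient ξ η a b c) :
    ∀ᶠ p in 𝓝 (midpoint ℝ a b), 0 < σ * orient ξ η a b p → p ∈ openCell t := by
  have hac : a ≠ c := by rintro rfl; simp [orient_left] at hσ
  have hbc : b ≠ c := by rintro rfl; simp [orient_right] at hσ
  rw [Finset.eq_insert_insert_of_card_eq_three (hK.mem_triangles.1 ht).2 ha hb hc
    (fun h => hξ.ne (congrArg ξ h)) hac hbc]
  exact _root_.eventually_mem_openCell hinj hξ hσ

/-- Both open triangles contain all points of this side close enough to the midpoint of `ab`, and
faces whose open cells meet are equal. -/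
theorem IsTriangulation.eq_of_same_side (hK : IsTriangulation S K)
    (hinj : ∀ p q, ξ p = ξ q → η p = η q → p = q) {t t' : Finset Plane}
    (ht : t ∈ triangles S K) (ht' : t' ∈ triangles S K) {a b c c' : Plane} (hξ : ξ a < ξ b)
    (ha : a ∈ t) (hb : b ∈ t) (hc : c ∈ t) (ha' : a ∈ t') (hb' : b ∈ t') (hc' : c' ∈ t') {σ : ℝ}
    (hσ : 0 < σ * orient ξ η a b c) (hσ' : 0 < σ * orient ξ η a b c') : t = t' := by
  obtain ⟨p, hp, h1, h2⟩ := ((frequently_orient_pos hσ).and_eventually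
    ((hK.eventually_mem_openCell hinj ht hξ ha hb hc hσ).and
      (hK.eventually_mem_openCell hinj ht' hξ ha' hb' hc' hσ'))).exists
  have htK := (hK.mem_triangles.1 ht).1
  have htK' := (hK.mem_triangles.1 ht').1
  exact (K.subset_of_mem_openCell htK htK' (h1 hp) (openCell_subset_convexHull _ (h2 hp))).antisymm
    (K.subset_of_mem_openCell htK' htK (h2 hp) (openCell_subset_convexHull _ (h1 hp)))

open Classical in
/-- The value of `A` at the triangle on a given side of an edge is the value of `A` close to the
edge on this side. -/
theorem IsTriangulation.sum_side (hK : IsTriangulation S K) (hS : ¬ Collinear ℝ (S : Set Plane))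
    (hinj : ∀ p q, ξ p = ξ q → η p = η q → p = q) (A : Plane → ZMod 2)
    (hAt : ∀ t ∈ triangles S K, ∀ p ∈ openCell t, ∀ q ∈ openCell t, A p = A q)
    (hAout : ∀ p ∉ convexHull ℝ (S : Set Plane), A p = 0) {a b : Plane}
    (hab : {a, b} ∈ K.faces) (hξ : ξ a < ξ b) {σ : ℝ} (hσ : ∃ z, 0 < σ * orient ξ η a b z)
    {B : ZMod 2} (hB : ∀ᶠ p in 𝓝 (midpoint ℝ a b), 0 < σ * orient ξ η a b p → A p = B) :
    ∑ t ∈ (triangles S K).filter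
      (fun t => a ∈ t ∧ b ∈ t ∧ ∃ c ∈ t, 0 < σ * orient ξ η a b c), A (barycenter t) = B := by
  have hne : a ≠ b := fun h => hξ.ne (congrArg ξ h)
  obtain ⟨z, hz⟩ := hσ
  by_cases hex : ∃ t ∈ triangles S K, a ∈ t ∧ b ∈ t ∧ ∃ c ∈ t, 0 < σ * orient ξ η a b c
  · obtain ⟨t, ht, ha, hb, c, hc, hσc⟩ := hex
    have hsing : (triangles S K).filter
        (fun t => a ∈ t ∧ b ∈ t ∧ ∃ c ∈ t, 0 < σ * orient ξ η a b c) = {t} := by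
      ext t'
      rw [Finset.mem_filter, Finset.mem_singleton]
      constructor
      · rintro ⟨ht', ha', hb', c', hc', hσc'⟩
        exact hK.eq_of_same_side hinj ht' ht hξ ha' hb' hc' ha hb hc hσc' hσc
      · rintro rfl
        exact ⟨ht, ha, hb, c, hc, hσc⟩
    obtain ⟨p, hp, h1, h2⟩ := ((frequently_orient_pos hz).and_eventually
      ((hK.eventually_mem_openCell hinj ht hξ ha hb hc hσc).and hB)).exists
    rw [hsing, Finset.sum_singleton, ← h2 hp]
    exact hAt t ht _ (barycenter_mem_openCell ⟨a, ha⟩) _ (h1 hp)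
  · have hempty : (triangles S K).filter
        (fun t => a ∈ t ∧ b ∈ t ∧ ∃ c ∈ t, 0 < σ * orient ξ η a b c) = ∅ :=
      Finset.filter_eq_empty_iff.2 fun t ht h => hex ⟨t, ht, h⟩
    rw [hempty, Finset.sum_empty]
    -- With no triangle on this side, nearby points of the side lie outside the hull: a triangle
    -- containing one would contain the midpoint, hence have the edge `ab`, hence lie in the
    -- opposite closed half-plane.
    have hclosed : ∀ᶠ p in 𝓝 (midpoint ℝ a b), ∀ t ∈ triangles S K,
        p ∈ convexHull ℝ (t : Set Plane) → midpoint ℝ a b ∈ convexHull ℝ (t : Set Plane) := by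
      refine (Finset.eventually_all _).2 fun t _ => ?_
      by_cases hm : midpoint ℝ a b ∈ convexHull ℝ (t : Set Plane)
      · exact Eventually.of_forall fun _ _ => hm
      · filter_upwards [(t.finite_toSet.isClosed_convexHull (𝕜 := ℝ)).isOpen_compl.mem_nhds hm]
          with p hp hp'
        exact absurd hp' hp
    obtain ⟨p, hp, h1, h2⟩ := ((frequently_orient_pos hz).and_eventually (hclosed.and hB)).exists
    rw [← h2 hp]
    refine (hAout p fun hpS => ?_).symm
    obtain ⟨t, htK, hcard, hpt⟩ := hK.exists_triangle hS hpS
    have ht := hK.mem_triangles.2 ⟨htK, hcard⟩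
    have hsub := K.subset_of_mem_openCell hab htK (midpoint_mem_openCell hne) (h1 t ht hpt)
    have ha : a ∈ t := hsub (by simp)
    have hb : b ∈ t := hsub (by simp)
    obtain ⟨w, hw0, hw1, rfl⟩ := Finset.mem_convexHull'.1 hpt
    rw [orient_sum ξ η a b hw1, Finset.mul_sum] at hp
    refine not_le.2 hp (Finset.sum_nonpos fun v hv => ?_)
    rw [mul_left_comm]
    exact mul_nonpos_of_nonneg_of_nonpos (hw0 v hv)
      (not_lt.1 fun hlt => hex ⟨t, ht, ha, hb, v, hv, hlt⟩)

/-- A triangle with the edge `ab` lies on exactly one side of it. -/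
theorem IsTriangulation.exists_pos_orient (hK : IsTriangulation S K)
    (hinj : ∀ p q, ξ p = ξ q → η p = η q → p = q) {t : Finset Plane} (ht : t ∈ triangles S K)
    {a b : Plane} (hξ : ξ a < ξ b) (ha : a ∈ t) (hb : b ∈ t) :
    ((∃ c ∈ t, 0 < (1 : ℝ) * orient ξ η a b c) ∧ ¬ ∃ c ∈ t, 0 < (-1 : ℝ) * orient ξ η a b c) ∨
    ((∃ c ∈ t, 0 < (-1 : ℝ) * orient ξ η a b c) ∧ ¬ ∃ c ∈ t, 0 < (1 : ℝ) * orient ξ η a b c) := by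
  classical
  have hcard := (hK.mem_triangles.1 ht).2
  have hab : a ≠ b := fun h => hξ.ne (congrArg ξ h)
  obtain ⟨c, hc, hcab⟩ : ∃ c ∈ t, c ∉ ({a, b} : Finset Plane) := by
    refine Finset.exists_mem_notMem_of_card_lt_card ?_
    rw [Finset.card_pair hab, hcard]; norm_num
  simp only [Finset.mem_insert, Finset.mem_singleton, not_or] at hcab
  have h0 := hK.orient_ne_zero (η := η) hinj ht ha hb hc hξ (Ne.symm hcab.1) (Ne.symm hcab.2)
  rw [Finset.eq_insert_insert_of_card_eq_three hcard ha hb hc hab (Ne.symm hcab.1)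
    (Ne.symm hcab.2)]
  simp only [Finset.mem_insert, Finset.mem_singleton, exists_eq_or_imp, exists_eq_left,
    orient_left, orient_right]
  rcases lt_or_gt_of_ne h0 with h | h
  · right; simp [h, h.le]
  · left; simp [h, h.le]

end Triangles

/-- Coordinates of the plane such that distinct points of `S` have distinct abscissas. -/
theorem exists_coordinates (S : Finset Plane) : ∃ ξ η : Plane →L[ℝ] ℝ,
    Set.InjOn ξ (S : Set Plane) ∧ (∀ p q, ξ p = ξ q → η p = η q → p = q) ∧
      ∃ e, ξ e = 0 ∧ η e = 1 := by
  classical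
  -- The excluded shears are those giving two sites of different ordinates the same abscissa.
  obtain ⟨s, hs⟩ := Infinite.exists_notMem_finset
    ((S ×ˢ S).image fun v : Plane × Plane => -(v.1 0 - v.2 0) / (v.1 1 - v.2 1))
  have hinj : ∀ p q : Plane, p 0 + s * p 1 = q 0 + s * q 1 → p 1 = q 1 → p = q := by
    intro p q h0 h1
    ext i
    fin_cases i
    · rw [h1] at h0; simpa using h0
    · exact h1
  refine ⟨EuclideanSpace.proj (0 : Fin 2) + s • EuclideanSpace.proj (1 : Fin 2),
    EuclideanSpace.proj (1 : Fin 2), ?_, ?_, !₂[-s, 1], ?_, ?_⟩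
  · intro v hv v' hv' h
    have h : v 0 + s * v 1 = v' 0 + s * v' 1 := by simpa using h
    by_cases h1 : v 1 = v' 1
    · exact hinj v v' h h1
    · refine absurd (Finset.mem_image.2 ⟨(v, v'), Finset.mem_product.2 ⟨hv, hv'⟩, ?_⟩) hs
      rw [div_eq_iff (sub_ne_zero.2 h1)]
      linear_combination -h
  · intro p q h0 h1
    exact hinj p q (by simpa using h0) (by simpa using h1)
  · simp
  · simp

/-- Expand `det (M * N)` multilinearly in the rows, as a sum over all maps `φ`. Terms with
non-injective `φ` repeat a row of `N` and vanish. The determinant is nonzero, so some injective `φ`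
has a nonzero product of entries of `M`. -/
theorem Matrix.exists_injective_of_mul_eq_one {m n R : Type*} [Fintype m] [Fintype n]
    [DecidableEq m] [CommRing R] [Nontrivial R] (M : Matrix m n R) (N : Matrix n m R)
    (h : M * N = 1) : ∃ φ : m → n, Function.Injective φ ∧ ∀ i, M i (φ i) ≠ 0 := by
  by_contra! hno
  have hdet : (M * N).det = 0 := by
    have hrow : M * N = fun i => ∑ j, M i j • N j := by
      ext i k
      simp [Matrix.mul_apply, Finset.sum_apply]
    change Matrix.detRowAlternating (M * N) = 0
    rw [hrow]
    change Matrix.detRowAlternating.toMultilinearMap (fun i => ∑ j, M i j • N j) = 0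
    rw [MultilinearMap.map_sum]
    refine Finset.sum_eq_zero fun φ _ => ?_
    rw [MultilinearMap.map_smul_univ]
    by_cases hφ : Function.Injective φ
    · obtain ⟨i, hi⟩ := hno φ hφ
      rw [Finset.prod_eq_zero (Finset.mem_univ i) hi, zero_smul]
    · have : Matrix.detRowAlternating.toMultilinearMap (fun i => N (φ i)) = 0 := by
        obtain ⟨i, j, hij, hne⟩ := Function.not_injective_iff.1 hφ
        exact Matrix.detRowAlternating.map_eq_zero_of_eq _ (congrArg N hij) hne
      rw [this, smul_zero]
  rw [h, Matrix.det_one] at hdet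
  exact one_ne_zero hdet

/-! ### Assigning non-tree edges to distinct triangles -/

section Edges

variable {S : Finset Plane} {K : Geometry.SimplicialComplex ℝ Plane}

/-- An edge meeting the open triangle would have to contain its three vertices. -/
theorem IsTriangulation.parity_eq_of_mem_openCell (hK : IsTriangulation S K)
    {ξ η : Plane →L[ℝ] ℝ} (hinj : ∀ p q, ξ p = ξ q → η p = η q → p = q)
    (hξS : Set.InjOn ξ (S : Set Plane)) {u : S} (w : (edgeGraph S K).Walk u u)
    {t : Finset Plane} (ht : t ∈ triangles S K) {p q : Plane} (hp : p ∈ openCell t)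
    (hq : q ∈ openCell t) : parity ξ η w p = parity ξ η w q := by
  classical
  obtain ⟨htK, hcard⟩ := hK.mem_triangles.1 ht
  refine parity_eq_of_isPreconnected hinj hξS w (convex_openCell t).isPreconnected ?_ hp hq
  intro p hp a b hab hpab
  have h := K.subset_of_mem_openCell htK hab.2 hp (by
    rw [Finset.coe_pair, convexHull_pair]; exact hpab)
  have := Finset.card_le_card h
  have h2 := Finset.card_le_two (a := (a : Plane)) (b := b)
  omega

-- The two sides of `ab` have parities `B` and `B` plus the multiplicity of `ab`, so `B` cancels in
-- the sum. On a boundary edge the missing triangle is accounted for by the parity zero outside the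
-- hull.
open Classical in
theorem IsTriangulation.sum_parity (hK : IsTriangulation S K)
    (hS : ¬ Collinear ℝ (S : Set Plane)) {ξ η : Plane →L[ℝ] ℝ}
    (hinj : ∀ p q, ξ p = ξ q → η p = η q → p = q) (hξS : Set.InjOn ξ (S : Set Plane))
    (hη : ∃ e, ξ e = 0 ∧ η e = 1) {u : S} (w : (edgeGraph S K).Walk u u) {a b : S}
    (hab : (edgeGraph S K).Adj a b) (hξ : ξ a < ξ b) :
    ∑ t ∈ (triangles S K).filter (fun t => (a : Plane) ∈ t ∧ (b : Plane) ∈ t),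
      parity ξ η w (barycenter t) = w.edges.count s(a, b) := by
  have hne : (a : Plane) ≠ b := fun h => hξ.ne (congrArg ξ h)
  have hAt : ∀ t ∈ triangles S K, ∀ p ∈ openCell t, ∀ q ∈ openCell t,
      parity ξ η w p = parity ξ η w q :=
    fun t ht p hp q hq => hK.parity_eq_of_mem_openCell hinj hξS w ht hp hq
  have hAout : ∀ p ∉ convexHull ℝ (S : Set Plane), parity ξ η w p = 0 := by
    intro p hp
    by_cases h : ξ a = ξ p
    · exact parity_eq_zero_of_notMem_convexHull hinj hξS w hp b.2 (h ▸ hξ.ne')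
    · exact parity_eq_zero_of_notMem_convexHull hinj hξS w hp a.2 h
  have hmid : ∀ c d : S, (edgeGraph S K).Adj c d →
      midpoint ℝ (a : Plane) b ∈ segment ℝ (c : Plane) d → s(c, d) = s(a, b) := by
    intro c d hcd hm
    have h := K.subset_of_mem_openCell hab.2 hcd.2 (midpoint_mem_openCell hne) (by
      rw [Finset.coe_pair, convexHull_pair]; exact hm)
    have ha := h (Finset.mem_insert_self _ _)
    have hb := h (Finset.mem_insert_of_mem (Finset.mem_singleton_self _))
    simp only [Finset.mem_insert, Finset.mem_singleton, Subtype.coe_inj] at ha hb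
    have hab' : a ≠ b := hab.1
    rw [Sym2.eq_iff]
    grind
  obtain ⟨B, hB⟩ := exists_eventually_parity_eq hinj hξS w hξ hmid (η := η)
  obtain ⟨e, he0, he1⟩ := hη
  have hside : ∀ τ : ℝ, orient ξ η a b (a + τ • e) = (ξ b - ξ a) * τ := by
    intro τ
    unfold orient
    simp only [map_add, map_smul, smul_eq_mul, he0, he1]
    ring
  have hpos := hK.sum_side hS hinj _ hAt hAout hab.2 hξ (σ := 1)
    ⟨a + (1 : ℝ) • e, by rw [hside]; linarith⟩ (B := B) (by
      filter_upwards [hB] with p hp h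
      rw [hp, if_neg (by linarith), mul_zero, add_zero])
  have hneg := hK.sum_side hS hinj _ hAt hAout hab.2 hξ (σ := -1)
    ⟨a + (-1 : ℝ) • e, by rw [hside]; linarith⟩ (B := B + w.edges.count s(a, b)) (by
      filter_upwards [hB] with p hp h
      rw [hp, if_pos (by linarith), mul_one])
  have hsplit : (triangles S K).filter (fun t => (a : Plane) ∈ t ∧ (b : Plane) ∈ t) =
      (triangles S K).filter (fun t => (a : Plane) ∈ t ∧ (b : Plane) ∈ t ∧
        ∃ c ∈ t, 0 < (1 : ℝ) * orient ξ η a b c) ∪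
      (triangles S K).filter (fun t => (a : Plane) ∈ t ∧ (b : Plane) ∈ t ∧
        ∃ c ∈ t, 0 < (-1 : ℝ) * orient ξ η a b c) := by
    rw [← Finset.filter_or]
    refine Finset.filter_congr fun t ht => ⟨fun ⟨ha, hb⟩ => ?_, ?_⟩
    · rcases hK.exists_pos_orient (η := η) hinj ht hξ ha hb with h | h
      exacts [Or.inl ⟨ha, hb, h.1⟩, Or.inr ⟨ha, hb, h.1⟩]
    · rintro (⟨ha, hb, -⟩ | ⟨ha, hb, -⟩) <;> exact ⟨ha, hb⟩
  rw [hsplit, Finset.sum_union, hpos, hneg]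
  · linear_combination CharTwo.add_self_eq_zero B
  · refine Finset.disjoint_filter.2 fun t ht h1 h2 => ?_
    rcases hK.exists_pos_orient (η := η) hinj ht hξ h1.1 h1.2.1 with h | h
    exacts [h.2 h2.2.2, h.2 h1.2.2]

open Classical in
/-- An edge belongs to at most two triangles. -/
theorem IsTriangulation.card_triangles_le_two (hK : IsTriangulation S K) {a b : Plane}
    (ha : a ∈ S) (hb : b ∈ S) (hab : a ≠ b) :
    ((triangles S K).filter fun t => a ∈ t ∧ b ∈ t).card ≤ 2 := by
  obtain ⟨ξ, η, hξS, hinj, -⟩ := exists_coordinates S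
  wlog hξ : ξ a < ξ b generalizing a b
  · have h := this hb ha hab.symm
      (lt_of_le_of_ne (not_lt.1 hξ) fun h => hab (hξS ha hb h.symm))
    simpa only [and_comm] using h
  have hsub : (triangles S K).filter (fun t => a ∈ t ∧ b ∈ t) ⊆
      (triangles S K).filter (fun t => a ∈ t ∧ b ∈ t ∧
        ∃ c ∈ t, 0 < (1 : ℝ) * orient ξ η a b c) ∪
      (triangles S K).filter (fun t => a ∈ t ∧ b ∈ t ∧
        ∃ c ∈ t, 0 < (-1 : ℝ) * orient ξ η a b c) := by
    rw [← Finset.filter_or]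
    intro t h
    obtain ⟨ht, ha, hb⟩ := Finset.mem_filter.1 h
    refine Finset.mem_filter.2 ⟨ht, ?_⟩
    rcases hK.exists_pos_orient (η := η) hinj ht hξ ha hb with h | h
    exacts [Or.inl ⟨ha, hb, h.1⟩, Or.inr ⟨ha, hb, h.1⟩]
  have hone : ∀ σ : ℝ, ((triangles S K).filter (fun t => a ∈ t ∧ b ∈ t ∧
      ∃ c ∈ t, 0 < σ * orient ξ η a b c)).card ≤ 1 := by
    intro σ
    refine Finset.card_le_one.2 fun t ht t' ht' => ?_
    obtain ⟨ht, ha, hb, c, hc, hσ⟩ := Finset.mem_filter.1 ht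
    obtain ⟨ht', ha', hb', c', hc', hσ'⟩ := Finset.mem_filter.1 ht'
    exact hK.eq_of_same_side hinj ht ht' hξ ha hb hc ha' hb' hc' hσ hσ'
  have h1 := Finset.card_le_card hsub
  have h2 := Finset.card_union_le ((triangles S K).filter (fun t => a ∈ t ∧ b ∈ t ∧
        ∃ c ∈ t, 0 < (1 : ℝ) * orient ξ η a b c)) ((triangles S K).filter (fun t => a ∈ t ∧ b ∈ t ∧
        ∃ c ∈ t, 0 < (-1 : ℝ) * orient ξ η a b c))
  have h3 := hone 1
  have h4 := hone (-1)
  omega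

/-- The end points of the edge `e` are vertices of `t`. -/
def edgeIn (e : Sym2 S) (t : Finset Plane) : Prop := ∀ v ∈ e, (v : Plane) ∈ t

theorem edgeIn_mk {a b : S} {t : Finset Plane} :
    edgeIn s(a, b) t ↔ (a : Plane) ∈ t ∧ (b : Plane) ∈ t := by
  simp [edgeIn]

/-- The fundamental cycle: the edge `e`, then back inside `T`. The way back may be any walk, as only
edges outside `T` are counted. -/
theorem exists_closed_walk {V : Type*} [DecidableEq V] {G T : SimpleGraph V} (hT : T.Connected) (hTG : T ≤ G)
    {e : Sym2 V} (heG : e ∈ G.edgeSet) : ∃ (u : V) (w : G.Walk u u),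
      ∀ f ∉ T.edgeSet, w.edges.count f = if e = f then 1 else 0 := by
  induction e with
  | _ a b =>
    have hab : G.Adj a b := heG
    obtain ⟨w⟩ := hT.preconnected b a
    refine ⟨a, SimpleGraph.Walk.cons hab (w.mapLe hTG), fun f hf => ?_⟩
    have h0 : (w.mapLe hTG).edges.count f = 0 := by
      rw [List.count_eq_zero, SimpleGraph.Walk.edges_mapLe_eq_edges]
      exact fun h => hf (w.edges_subset_edgeSet h)
    rw [SimpleGraph.Walk.edges_cons, List.count_cons, h0]
    simp

/-- The edges outside a spanning tree can be assigned to distinct triangles that contain them. -/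
theorem IsTriangulation.exists_injective (hK : IsTriangulation S K)
    (hS : ¬ Collinear ℝ (S : Set Plane)) {T : SimpleGraph S} (hT : T.Connected)
    (hTG : T ≤ edgeGraph S K) :
    ∃ φ : {e // e ∈ (edgeGraph S K).edgeSet \ T.edgeSet} → {t // t ∈ triangles S K},
      Function.Injective φ ∧ ∀ e, edgeIn e.1 (φ e).1 := by
  classical
  obtain ⟨ξ, η, hξS, hinj, hη⟩ := exists_coordinates S
  choose u w hw using fun e : {e // e ∈ (edgeGraph S K).edgeSet \ T.edgeSet} =>
    exists_closed_walk hT hTG e.2.1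
  -- An entry of `M * N` sums the parity of the walk of `e` over the triangles at `f`. This is the
  -- multiplicity of `f` in that walk, which is 1 for `f = e` and 0 otherwise.
  let M : Matrix {e // e ∈ (edgeGraph S K).edgeSet \ T.edgeSet} {t // t ∈ triangles S K} (ZMod 2) :=
    fun e t => if edgeIn e.1 t.1 then 1 else 0
  let N : Matrix {t // t ∈ triangles S K} {e // e ∈ (edgeGraph S K).edgeSet \ T.edgeSet} (ZMod 2) :=
    fun t e => parity ξ η (w e) (barycenter t.1)
  have hMN : M * N = 1 := by
    ext f e
    have hsum : ∀ g ∈ (edgeGraph S K).edgeSet,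
        ∑ t ∈ (triangles S K).filter (fun t => edgeIn g t), parity ξ η (w e) (barycenter t) =
          (w e).edges.count g := by
      intro g hg
      induction g with
      | _ a b =>
        have hab : (edgeGraph S K).Adj a b := hg
        have hξ : ξ a ≠ ξ b := fun h => hab.ne (Subtype.ext (hξS a.2 b.2 h))
        simp only [edgeIn_mk]
        rcases lt_or_gt_of_ne hξ with h | h
        · exact hK.sum_parity hS hinj hξS hη (w e) hab h
        · rw [Sym2.eq_swap, ← hK.sum_parity hS hinj hξS hη (w e) hab.symm h]
          simp only [and_comm]
    rw [Matrix.mul_apply, Matrix.one_apply]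
    have h1 := hsum f.1 f.2.1
    rw [hw e f.1 f.2.2, Finset.sum_filter, ← Finset.sum_coe_sort] at h1
    simp only [M, N, ite_mul, one_mul, zero_mul]
    rw [h1]
    by_cases hef : f = e
    · simp [hef]
    · rw [if_neg hef, if_neg fun h => hef (Subtype.ext h.symm)]; rfl
  obtain ⟨φ, hφ, hφM⟩ := Matrix.exists_injective_of_mul_eq_one M N hMN
  refine ⟨φ, hφ, fun e => ?_⟩
  by_contra h
  exact hφM e (if_neg h)

end Edges

/-! ### Angle bound and summation of edge lengths -/

section Angles

open EuclideanGeometry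

/-- Projecting the other two sides onto `ab` gives `|ab| = |ac| cos A + |bc| cos B`, and both
cosines are at most `cos α`. -/
theorem dist_le_cos_mul {α : ℝ} (hα : 0 ≤ α) {a b c : Plane} (hab : a ≠ b)
    (ha : α ≤ angle b a c) (hb : α ≤ angle a b c) :
    dist a b ≤ Real.cos α * (dist a c + dist b c) := by
  have h1 : Real.cos (angle b a c) ≤ Real.cos α :=
    Real.cos_le_cos_of_nonneg_of_le_pi hα (angle_le_pi _ _ _) ha
  have h2 : Real.cos (angle a b c) ≤ Real.cos α :=
    Real.cos_le_cos_of_nonneg_of_le_pi hα (angle_le_pi _ _ _) hb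
  have e1 := InnerProductGeometry.cos_angle_mul_norm_mul_norm (b -ᵥ a) (c -ᵥ a)
  have e2 := InnerProductGeometry.cos_angle_mul_norm_mul_norm (a -ᵥ b) (c -ᵥ b)
  rw [← dist_eq_norm_vsub, ← dist_eq_norm_vsub, dist_comm b a, dist_comm c a] at e1
  rw [← dist_eq_norm_vsub, ← dist_eq_norm_vsub, dist_comm c b] at e2
  have hpos : 0 < dist a b := dist_pos.2 hab
  have e3 : inner ℝ (b -ᵥ a) (c -ᵥ a) + inner ℝ (a -ᵥ b) (c -ᵥ b) = dist a b * dist a b := by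
    rw [dist_eq_norm_vsub Plane a b, ← real_inner_self_eq_norm_mul_norm]
    simp only [vsub_eq_sub, inner_sub_left, inner_sub_right]
    rw [real_inner_comm b a]
    ring
  unfold EuclideanGeometry.angle at h1 h2
  have h3 := mul_le_mul_of_nonneg_right h1 (mul_nonneg hpos.le (dist_nonneg (x := a) (y := c)))
  have h4 := mul_le_mul_of_nonneg_right h2 (mul_nonneg hpos.le (dist_nonneg (x := b) (y := c)))
  refine le_of_mul_le_mul_left ?_ hpos
  nlinarith

end Angles

section Weights

open EuclideanGeometry

variable {S : Finset Plane} {K : Geometry.SimplicialComplex ℝ Plane}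

/-- Every edge of a triangle is at most `cos α` times the sum of the other two. -/
theorem IsTriangulation.edgeLength_le (hK : IsTriangulation S K) {α : ℝ} (hα : 0 ≤ α)
    (hangle : AnglesAtLeast K α) (hcos : 0 ≤ Real.cos α) {e : Sym2 S}
    (he : e ∈ (edgeGraph S K).edgeSet) {t : Finset Plane} (ht : t ∈ triangles S K)
    (het : edgeIn e t) {F : Finset (Sym2 S)}
    (hF : ∀ g ∈ (edgeGraph S K).edgeSet, edgeIn g t → g ≠ e → g ∈ F) :
    edgeLength e ≤ Real.cos α * ∑ g ∈ F, edgeLength g := by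
  classical
  induction e with
  | _ a b =>
    obtain ⟨htK, hcard⟩ := hK.mem_triangles.1 ht
    obtain ⟨ha, hb⟩ := edgeIn_mk.1 het
    have hab : (edgeGraph S K).Adj a b := he
    have hne : (a : Plane) ≠ b := fun h => hab.ne (Subtype.ext h)
    obtain ⟨c, hc, hcab⟩ : ∃ c ∈ t, c ∉ ({(a : Plane), (b : Plane)} : Finset Plane) := by
      refine Finset.exists_mem_notMem_of_card_lt_card ?_
      rw [Finset.card_pair hne, hcard]; norm_num
    simp only [Finset.mem_insert, Finset.mem_singleton, not_or] at hcab
    lift c to S using hK.subset_sites htK hc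
    obtain ⟨hca, hcb⟩ := hcab
    have hca' : c ≠ a := fun h => hca (congrArg _ h)
    have hcb' : c ≠ b := fun h => hcb (congrArg _ h)
    have hadj : ∀ x : S, (x : Plane) ∈ t → x ≠ c → (edgeGraph S K).Adj x c := fun x hx hxc =>
      ⟨hxc, K.down_closed htK (Finset.insert_subset hx (Finset.singleton_subset_iff.2 hc))
        ⟨x, Finset.mem_insert_self _ _⟩⟩
    have hac := hadj a ha hca'.symm
    have hbc := hadj b hb hcb'.symm
    have h1 := dist_le_cos_mul hα hne
      (hangle t htK hcard b hb a ha c hc hne.symm (Ne.symm hca) (Ne.symm hcb))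
      (hangle t htK hcard a ha b hb c hc hne (Ne.symm hcb) (Ne.symm hca))
    have hne2 : s(a, c) ≠ s(b, c) := by
      rw [Ne, Sym2.eq_iff]
      rintro (⟨h, -⟩ | ⟨-, h⟩)
      exacts [hab.ne h, hcb' h]
    have hsub : ({s(a, c), s(b, c)} : Finset (Sym2 S)) ⊆ F := by
      intro g hg
      rcases Finset.mem_insert.1 hg with rfl | hg
      · refine hF _ hac (edgeIn_mk.2 ⟨ha, hc⟩) ?_
        rw [Ne, Sym2.eq_iff]
        rintro (⟨-, h⟩ | ⟨-, h⟩)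
        exacts [hcb' h, hca' h]
      · rw [Finset.mem_singleton.1 hg]
        refine hF _ hbc (edgeIn_mk.2 ⟨hb, hc⟩) ?_
        rw [Ne, Sym2.eq_iff]
        rintro (⟨-, h⟩ | ⟨-, h⟩)
        exacts [hcb' h, hca' h]
    have h2 := Finset.sum_le_sum_of_subset_of_nonneg (f := edgeLength) hsub
      fun g _ _ => edgeLength_nonneg g
    rw [Finset.sum_pair hne2] at h2
    exact h1.trans (mul_le_mul_of_nonneg_left h2 hcos)

/-- A lower bound for all angles of a triangulation is at most `π / 3`. -/
theorem IsTriangulation.le_pi_div_three (hK : IsTriangulation S K)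
    (hS : ¬ Collinear ℝ (S : Set Plane)) {α : ℝ} (hangle : AnglesAtLeast K α) :
    α ≤ Real.pi / 3 := by
  classical
  have hne : S.Nonempty := by
    by_contra h
    rw [Finset.not_nonempty_iff_eq_empty] at h
    exact hS (by rw [h, Finset.coe_empty]; exact collinear_empty ℝ Plane)
  obtain ⟨x, hx⟩ := hne
  obtain ⟨t, htK, hcard, -⟩ := hK.exists_triangle hS (subset_convexHull ℝ _ hx)
  obtain ⟨a, b, c, hab, hac, hbc, rfl⟩ := Finset.card_eq_three.1 hcard
  have h := angle_add_angle_add_angle_eq_pi (p₁ := a) (p₂ := b) c hab.symm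
  have h1 := hangle _ htK hcard a (by simp) b (by simp) c (by simp) hab hbc hac
  have h2 := hangle _ htK hcard b (by simp) c (by simp) a (by simp) hbc hac.symm hab.symm
  have h3 := hangle _ htK hcard c (by simp) a (by simp) b (by simp) hac.symm hab hbc.symm
  linarith

/-- If every edge outside a spanning tree is assigned to a triangle, then the total length of the
edges outside the tree is at most `cos α` times the weight of the triangulation with the edges
of the tree counted twice. -/
theorem IsTriangulation.weight_sub_le (hK : IsTriangulation S K)
    (hS : ¬ Collinear ℝ (S : Set Plane)) {T : SimpleGraph S} (hT : T.Connected)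
    (hTG : T ≤ edgeGraph S K) {α : ℝ} (hα : 0 ≤ α) (hangle : AnglesAtLeast K α)
    (hcos : 0 ≤ Real.cos α) :
    weight (edgeGraph S K) - weight T ≤
      Real.cos α * (weight (edgeGraph S K) + weight T) := by
  classical
  obtain ⟨φ, hφ, hφe⟩ := hK.exists_injective hS hT hTG
  set D := (edgeGraph S K).edgeFinset with hD
  have hsub : T.edgeFinset ⊆ D := SimpleGraph.edgeFinset_mono hTG
  have hDN : ∑ e ∈ D \ T.edgeFinset, edgeLength e =
      ∑ e : {e // e ∈ (edgeGraph S K).edgeSet \ T.edgeSet}, edgeLength e.1 :=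
    Finset.sum_subtype _ (fun e => by simp [hD]) _
  have hsplit := Finset.sum_sdiff (f := edgeLength) hsub
  -- How often `g` occurs as one of the other sides. For `g` outside the tree, its own triangle `φ
  -- g` drops out because `φ` is injective.
  have hmult : ∀ g ∈ D, ((Finset.univ.filter fun e => edgeIn g (φ e).1 ∧ g ≠ e.1).card : ℝ) ≤
      if g ∈ T.edgeFinset then 2 else 1 := by
    intro g hg
    have hgE : g ∈ (edgeGraph S K).edgeSet := SimpleGraph.mem_edgeFinset.1 hg
    have hcard : ((triangles S K).filter fun t => edgeIn g t).card ≤ 2 := by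
      induction g with
      | _ a b =>
        have hab : (edgeGraph S K).Adj a b := hgE
        simp only [edgeIn_mk]
        exact hK.card_triangles_le_two a.2 b.2 fun h => hab.ne (Subtype.ext h)
    have hinj : Function.Injective fun e => (φ e).1 := Subtype.val_injective.comp hφ
    rw [← Finset.card_image_of_injective _ hinj]
    split_ifs with hgT
    · have h : (Finset.univ.filter fun e => edgeIn g (φ e).1 ∧ g ≠ e.1).image (fun e => (φ e).1) ⊆
          (triangles S K).filter fun t => edgeIn g t := by
        intro t ht
        obtain ⟨e, he, rfl⟩ := Finset.mem_image.1 ht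
        exact Finset.mem_filter.2 ⟨(φ e).2, (Finset.mem_filter.1 he).2.1⟩
      exact_mod_cast (Finset.card_le_card h).trans hcard
    · have hgN : g ∈ (edgeGraph S K).edgeSet \ T.edgeSet :=
        ⟨hgE, fun h => hgT (SimpleGraph.mem_edgeFinset.2 h)⟩
      have h : (Finset.univ.filter fun e => edgeIn g (φ e).1 ∧ g ≠ e.1).image (fun e => (φ e).1) ⊆
          ((triangles S K).filter fun t => edgeIn g t).erase (φ ⟨g, hgN⟩).1 := by
        intro t ht
        obtain ⟨e, he, rfl⟩ := Finset.mem_image.1 ht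
        obtain ⟨h1, h2⟩ := (Finset.mem_filter.1 he).2
        refine Finset.mem_erase.2 ⟨fun h => h2 ?_, Finset.mem_filter.2 ⟨(φ e).2, h1⟩⟩
        exact (congrArg Subtype.val (hinj h)).symm
      have h1 := Finset.card_le_card h
      have h2 : (φ ⟨g, hgN⟩).1 ∈ (triangles S K).filter fun t => edgeIn g t :=
        Finset.mem_filter.2 ⟨(φ ⟨g, hgN⟩).2, hφe ⟨g, hgN⟩⟩
      rw [Finset.card_erase_of_mem h2] at h1
      exact_mod_cast h1.trans (by omega)
  have hmain : ∑ e ∈ D \ T.edgeFinset, edgeLength e ≤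
      Real.cos α * ∑ g ∈ D, edgeLength g * if g ∈ T.edgeFinset then 2 else 1 := by
    calc ∑ e ∈ D \ T.edgeFinset, edgeLength e
        ≤ ∑ e : {e // e ∈ (edgeGraph S K).edgeSet \ T.edgeSet}, Real.cos α *
            ∑ g ∈ D.filter (fun g => edgeIn g (φ e).1 ∧ g ≠ e.1), edgeLength g := by
          rw [hDN]
          exact Finset.sum_le_sum fun e _ =>
            hK.edgeLength_le hα hangle hcos e.2.1 (φ e).2 (hφe e) fun g hg h1 h2 =>
              Finset.mem_filter.2 ⟨SimpleGraph.mem_edgeFinset.2 hg, h1, h2⟩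
      _ = Real.cos α * ∑ g ∈ D, edgeLength g *
            (Finset.univ.filter fun e => edgeIn g (φ e).1 ∧ g ≠ e.1).card := by
          rw [← Finset.mul_sum]
          congr 1
          simp only [Finset.sum_filter]
          rw [Finset.sum_comm]
          refine Finset.sum_congr rfl fun g _ => ?_
          rw [← Finset.sum_filter, Finset.sum_const, nsmul_eq_mul, mul_comm]
      _ ≤ _ := mul_le_mul_of_nonneg_left (Finset.sum_le_sum fun g hg =>
          mul_le_mul_of_nonneg_left (hmult g hg) (edgeLength_nonneg g)) hcos
  have htwice : ∑ g ∈ D, edgeLength g * (if g ∈ T.edgeFinset then (2 : ℝ) else 1) =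
      ∑ g ∈ D, edgeLength g + ∑ g ∈ T.edgeFinset, edgeLength g := by
    rw [← Finset.inter_eq_right.2 hsub, ← Finset.filter_mem_eq_inter, Finset.sum_filter,
      ← Finset.sum_add_distrib]
    refine Finset.sum_congr rfl fun g hg => ?_
    simp only [Finset.mem_filter, hg, true_and]
    split_ifs <;> ring
  rw [htwice] at hmain
  rw [weight_eq_sum (edgeGraph S K), weight_eq_sum T, ← hsplit]
  rw [← hsplit] at hmain
  linarith

end Weights

theorem mainTheorem4 (S : Finset Plane) (hS : ¬ Collinear ℝ (S : Set Plane))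
    (K : Geometry.SimplicialComplex ℝ Plane) (hK : IsDelaunayTriangulation S K)
    (T : SimpleGraph S) (hT : IsEuclideanMST S T)
    (α : ℝ) (hα : 0 < α) (hangle : AnglesAtLeast K α) :
    weight (edgeGraph S K) ≤ (1 + Real.cos α) / (1 - Real.cos α) * weight T := by
  -- This bound makes `cos α` nonnegative, as the summation needs; with `0 < α` it also gives `cos α
  -- < 1`, so the final division is legitimate.
  have hα3 : α ≤ Real.pi / 3 := hK.le_pi_div_three hS hangle
  have hpi := Real.pi_pos
  have hcos : 0 ≤ Real.cos α := Real.cos_nonneg_of_neg_pi_div_two_le_of_le (by linarith)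
    (by linarith)
  have hcos1 : Real.cos α < 1 := by
    rw [← Real.cos_zero]
    exact Real.cos_lt_cos_of_nonneg_of_le_pi le_rfl (by linarith) hα
  have h := hK.weight_sub_le hS hT.isTree.connected (hT.le_edgeGraph hK hS) hα.le hangle hcos
  rw [div_mul_eq_mul_div, le_div_iff₀ (sub_pos.2 hcos1)]
  linarith
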